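/- A finite compact metric graph $\Gamma$ consists of finitely many (at least one) edges, i.e. compact intervals of positive length, whose end points are glued together at vertices (the classes of a partition of the set of end points; loops and multiple edges are allowed). The standard Laplacian $L^{\rm st}(\Gamma)=-\frac{d^2}{dx^2}$ in $L_2(\Gamma)$ is defined on the functions that belong to $W_2^2$ on every edge, are continuous at every vertex, and have the sum of normal derivatives zero at every vertex. Its eigenvalues, counted with multiplicities, are $0=\lambda_0\le\lambda_1(\Gamma)\le\lambda_2(\Gamma)\le\cdots$, and eigenfunctions are taken real. Let $\Gamma$ be a connected finite compact metric graph of total length $\mathcal L$, and let $\Gamma^*$ be a connected metric graph (with at least one edge) obtained from $\Gamma$ by deleting one edge of length $\ell$ between the vertices $V_1$ and $V_2$. Write $\lambda_1(\Gamma)=k_1^2$ with $k_1>0$, and assume that $$\left(\max_{\psi_1:\,L^{\rm st}(\Gamma)\psi_1=\lambda_1(\Gamma)\psi_1}\frac{(\psi_1(V_1)-\psi_1(V_2))^2}{(\psi_1(V_1)+\psi_1(V_2))^2}\,\cot^2\frac{k_1\ell}{2}-1\right)\frac{k_1}{2}\cot\frac{k_1\ell}{2}\ \ge\ (\mathcal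 L-\ell)^{-1},$$ where the maximum is taken over the eigenfunctions $\psi_1$ with $(\psi_1(V_1),\psi_1(V_2))\neq(0,0)$ (at least one of which is assumed to exist), and the quotient is $+\infty$ when $\psi_1(V_1)+\psi_1(V_2)=0$; if the maximum is $+\infty$, the inequality is read as $\cot\frac{k_1\ell}{2}>0$. The inequality includes the assumption that $\cot\frac{k_1\ell}{2}$ is defined, i.e. $\sin\frac{k_1\ell}{2}\ne0$. Then $$\lambda_1(\Gamma^*)\le\lambda_1(\Gamma).$$ -/

import Mathlib

open MeasureTheory Set
open scoped ENNReal

universe u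

/-- A metric graph with set of edges `E` (finiteness is supplied by `[Fintype E]`, multiple edges
and loops are allowed). The edge `e` is the interval `[0, len e]`, its end points are `(e, false)`
(the point `0`) and `(e, true)` (the point `len e`). The vertices are the classes of a partition of
the set of all end points, given by the equivalence relation `glue`. -/
structure MetricGraph (E : Type u) where
  len : E → ℝ
  len_pos : ∀ e, 0 < len e
  glue : Setoid (E × Bool)

namespace MetricGraph

variable {E : Type u}

/-- A metric graph is connected if it has at least one edge and any two edges are joined by a chain
of edges in which consecutive edges have a common vertex. -/
def Connected (Γ : MetricGraph E) : Prop :=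
  Nonempty E ∧
    ∀ a b : E, Relation.ReflTransGen (fun c d => ∃ i j : Bool, Γ.glue (c, i) (d, j)) a b

/-- The total length. -/
noncomputable def totalLength [Fintype E] (Γ : MetricGraph E) : ℝ := ∑ e, Γ.len e

/-- The graph obtained by deleting the edge `e`; the other edges remain joined as before. -/
def deleteEdge (Γ : MetricGraph E) (e : E) : MetricGraph {a : E // a ≠ e} where
  len a := Γ.len a
  len_pos a := Γ.len_pos a
  glue := Γ.glue.comap fun p => ((p.1 : E), p.2)

/-- Real functions on the disjoint union of the closed edges (used for the continuous
representatives of Sobolev functions). -/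
abbrev Func (Γ : MetricGraph E) : Type u := ∀ e : E, Icc (0 : ℝ) (Γ.len e) → ℝ

/-- The point of the edge `p.1` that corresponds to the end point `p`. -/
noncomputable def endPoint (Γ : MetricGraph E) (p : E × Bool) : Icc (0 : ℝ) (Γ.len p.1) :=
  if p.2 then ⟨Γ.len p.1, (Γ.len_pos p.1).le, le_rfl⟩ else ⟨0, le_rfl, (Γ.len_pos p.1).le⟩

/-- The value of a function at the end point `p`. If the function is continuous at the vertices,
this is its value at the vertex that contains `p`. -/
noncomputable def endValue (Γ : MetricGraph E) (u : Γ.Func) (p : E × Bool) : ℝ :=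
  u p.1 (Γ.endPoint p)

/-- The derivative at the end point `p`, taken in the direction into the edge, of a function whose
derivative on the edge `e` is `du e`. -/
def normalDeriv (Γ : MetricGraph E) (du : E → ℝ → ℝ) (p : E × Bool) : ℝ :=
  if p.2 then -du p.1 (Γ.len p.1) else du p.1 0

/-- `u` is (the continuous representative of) a function of the Sobolev space `W₂²` of the interval
`[0, ℓ]`, with absolutely continuous first derivative `du` and square integrable
second derivative `ddu`. -/
structure IsSobolev22 (ℓ : ℝ) (u : Icc (0 : ℝ) ℓ → ℝ) (du ddu : ℝ → ℝ) : Prop where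
  memLp : MemLp ddu 2 (volume.restrict (Icc 0 ℓ))
  integral_ddu : ∀ x ∈ Icc 0 ℓ, ∀ y ∈ Icc 0 ℓ, du y - du x = ∫ t in x..y, ddu t
  integral_du : ∀ x y : Icc (0 : ℝ) ℓ, u y - u x = ∫ t in (x : ℝ)..y, du t

open scoped Classical in
/-- `u`, with derivatives `du` and `ddu` on the edges, belongs to the domain of the standard
Laplacian: it is in `W₂²` on every edge and satisfies the standard matching conditions. -/
structure InDomain [Fintype E] (Γ : MetricGraph E) (u : Γ.Func) (du ddu : E → ℝ → ℝ) : Prop where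
  sobolev : ∀ e, IsSobolev22 (Γ.len e) (u e) (du e) (ddu e)
  continuous_vertex : ∀ p q : E × Bool, Γ.glue p q → Γ.endValue u p = Γ.endValue u q
  kirchhoff : ∀ p : E × Bool, ∑ q : E × Bool with Γ.glue p q, Γ.normalDeriv du q = 0

/-- `ψ` is a (real) eigenfunction of the standard Laplacian `-d²/dx²` for the eigenvalue `lam`. -/
def IsEigenfunction [Fintype E] (Γ : MetricGraph E) (lam : ℝ) (ψ : Γ.Func) : Prop :=
  ψ ≠ 0 ∧ ∃ dψ ddψ : E → ℝ → ℝ, Γ.InDomain ψ dψ ddψ ∧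
    ∀ e, ∀ᵐ x : ℝ, ∀ hx : x ∈ Icc 0 (Γ.len e), -ddψ e x = lam * ψ e ⟨x, hx⟩

/-- The eigenvalues of the standard Laplacian other than the lowest one `λ₀`, counted with
multiplicities: eigenvalues with an eigenfunction that is linearly independent of an eigenfunction
for the same or a lower eigenvalue. -/
def excitedEigenvalues [Fintype E] (Γ : MetricGraph E) : Set ℝ :=
  {lam | ∃ mu ≤ lam, ∃ φ ψ : Γ.Func, Γ.IsEigenfunction mu φ ∧ Γ.IsEigenfunction lam ψ ∧
    LinearIndependent ℝ ![φ, ψ]}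

/-- The first excited eigenvalue `λ₁`, that is, the second lowest eigenvalue counted with
multiplicities. -/
noncomputable def lambdaOne [Fintype E] (Γ : MetricGraph E) : ℝ := sInf Γ.excitedEigenvalues

/-- The set of the quotients `(ψ(V₁) - ψ(V₂))² / (ψ(V₁) + ψ(V₂))²`, where `V₁`, `V₂` are the two
ends of the edge `e` and `ψ` runs over the eigenfunctions for the first excited eigenvalue that do
not vanish at both `V₁` and `V₂`. The quotient is `∞` if `ψ(V₁) + ψ(V₂) = 0`. -/
noncomputable def endRatios [Fintype E] (Γ : MetricGraph E) (e : E) : Set ℝ≥0∞ :=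
  {r | ∃ ψ : Γ.Func, Γ.IsEigenfunction Γ.lambdaOne ψ ∧
    ¬ (Γ.endValue ψ (e, false) = 0 ∧ Γ.endValue ψ (e, true) = 0) ∧
    r = ENNReal.ofReal ((Γ.endValue ψ (e, false) - Γ.endValue ψ (e, true)) ^ 2) /
      ENNReal.ofReal ((Γ.endValue ψ (e, false) + Γ.endValue ψ (e, true)) ^ 2)}

end MetricGraph

/-! Let ψ be an eigenfunction of Γ for k² that realizes the maximum; it has mean zero since k² ≠ 0.
Restrict it to Γ* and subtract its mean there. The result f is a trial function for λ₁(Γ*), so it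
suffices that f ≠ 0 and that its Rayleigh quotient is at most k².

Write L = 𝓛 − ℓ, m for the integral of ψ over the deleted edge, and Q for the increment of ψ'ψ along
it. Restriction removes k²∫ψ² + Q (integral over that edge) from the energy ∫ψ'² and ∫ψ² from the
mass; subtracting the mean removes a further m²/L from the mass. Hence ‖f'‖² = k²‖f‖² + k²m²/L − Q,
and the claim reduces to k²m²/L ≤ Q.

With θ = kℓ/2, x = ψ(V₁), y = ψ(V₂), the equation −ψ'' = k²ψ on the edge gives km = tan θ (x + y)
and Q = (k/2)(cot θ (x − y)² − tan θ (x + y)²). Divided by tan²θ (x + y)², the inequality is the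
hypothesis; for x + y = 0 it follows from cot θ > 0 (`boundary_term_ge`).

That λ₁ is attained and bounded by Rayleigh quotients is `Connected.isLeast_lambdaOne`: the direct
method on pairs (initial value, square integrable derivative) on the edges, then regularity of weak
solutions (`exists_isSolution_of_inner_eq`). -/

open Filter Topology

/-! ### Minimizers of abstract Rayleigh quotients -/

theorem IsCompactOperator.exists_forall_norm_sq_le {X F G : Type*}
    [NormedAddCommGroup X] [NormedSpace ℝ X] [CompleteSpace X]
    [NormedAddCommGroup F] [InnerProductSpace ℝ F]
    [NormedAddCommGroup G] [InnerProductSpace ℝ G]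
    {T : X →L[ℝ] F} (hT : IsCompactOperator T) (D : X →L[ℝ] G)
    {C : ℝ} (hC : ∀ v, ‖v‖ ≤ C * (‖T v‖ + ‖D v‖))
    (V : Submodule ℝ X) (hV : IsClosed (V : Set X)) (hne : ∃ v ∈ V, T v ≠ 0) :
    ∃ w ∈ V, ‖T w‖ = 1 ∧ ∀ v ∈ V, ‖D w‖ ^ 2 * ‖T v‖ ^ 2 ≤ ‖D v‖ ^ 2 := by
  set S : Set ℝ := {r | ∃ v ∈ V, ‖T v‖ = 1 ∧ ‖D v‖ ^ 2 = r} with hS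
  have hbdd : BddBelow S := ⟨0, by rintro _ ⟨v, -, -, rfl⟩; positivity⟩
  have hlow : ∀ v ∈ V, sInf S * ‖T v‖ ^ 2 ≤ ‖D v‖ ^ 2 := by
    intro v hv
    rcases eq_or_ne (T v) 0 with h0 | h0
    · simp [h0]
    have hpos : 0 < ‖T v‖ := norm_pos_iff.2 h0
    have hmem : (‖T v‖⁻¹) ^ 2 * ‖D v‖ ^ 2 ∈ S := by
      refine ⟨‖T v‖⁻¹ • v, V.smul_mem _ hv, ?_, ?_⟩
      · rw [map_smul, norm_smul, norm_inv, norm_norm, inv_mul_cancel₀ hpos.ne']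
      · rw [map_smul, norm_smul, norm_inv, norm_norm, mul_pow]
    have := csInf_le hbdd hmem
    rw [inv_pow, inv_mul_eq_div, le_div_iff₀ (by positivity)] at this
    exact this
  have hSne : S.Nonempty := by
    obtain ⟨v, hv, h0⟩ := hne
    have hpos : 0 < ‖T v‖ := norm_pos_iff.2 h0
    refine ⟨_, ‖T v‖⁻¹ • v, V.smul_mem _ hv, ?_, rfl⟩
    rw [map_smul, norm_smul, norm_inv, norm_norm, inv_mul_cancel₀ hpos.ne']
  have hlam : 0 ≤ sInf S := by
    refine le_csInf hSne ?_
    rintro _ ⟨v, -, -, rfl⟩; positivity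
  obtain ⟨r, -, hr, hrS⟩ := exists_seq_tendsto_sInf hSne hbdd
  choose v hvV hvT hvD using hrS
  obtain ⟨M, hM⟩ := hr.bddAbove_range
  have hvb : ∀ n, v n ∈ Metric.closedBall (0 : X) (|C| * (1 + √M)) := by
    intro n
    have h1 : ‖D (v n)‖ ≤ √M := by
      apply Real.le_sqrt_of_sq_le
      rw [hvD]; exact hM ⟨n, rfl⟩
    rw [mem_closedBall_zero_iff]
    calc ‖v n‖ ≤ C * (‖T (v n)‖ + ‖D (v n)‖) := hC _
      _ ≤ |C| * (‖T (v n)‖ + ‖D (v n)‖) := by gcongr; exact le_abs_self C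
      _ ≤ _ := by rw [hvT]; gcongr
  obtain ⟨K, hK, hKsub⟩ :=
    IsCompactOperator.image_closedBall_subset_compact (f := (T : X →ₗ[ℝ] F)) hT
      (|C| * (1 + √M))
  obtain ⟨y, -, φ, hφ, hy⟩ := hK.tendsto_subseq (x := fun n => T (v n))
    (fun n => hKsub ⟨v n, hvb n, rfl⟩)
  -- Parallelogram law for `D` and `T`, with the lower bound applied to `a + b`: near-minimizers
  -- with close images under `T` have close images under `D`. Coercivity then makes the minimizing
  -- subsequence Cauchy in `X`.
  have hkey : ∀ a ∈ V, ∀ b ∈ V, ‖T a‖ = 1 → ‖T b‖ = 1 → ‖D (a - b)‖ ^ 2 ≤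
      2 * (‖D a‖ ^ 2 - sInf S) + 2 * (‖D b‖ ^ 2 - sInf S) + sInf S * ‖T (a - b)‖ ^ 2 := by
    intro a ha b hb hTa hTb
    have h1 := parallelogram_law_with_norm ℝ (D a) (D b)
    have h2 := parallelogram_law_with_norm ℝ (T a) (T b)
    have h3 := hlow (a + b) (V.add_mem ha hb)
    simp only [map_add, map_sub] at *
    rw [hTa, hTb] at h2
    have h4 : ‖T a + T b‖ ^ 2 = 4 - ‖T a - T b‖ ^ 2 := by linarith
    rw [h4] at h3
    linarith
  have hTc := cauchySeq_iff_tendsto_dist_atTop_0.1 hy.cauchySeq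
  have hDs : Tendsto (fun n => ‖D (v (φ n))‖ ^ 2) atTop (𝓝 (sInf S)) := by
    simpa only [hvD, Function.comp_def] using hr.comp hφ.tendsto_atTop
  have hcau : CauchySeq (fun n => v (φ n)) := by
    rw [cauchySeq_iff_tendsto_dist_atTop_0]
    have hd1 : Tendsto (fun p : ℕ × ℕ => ‖D (v (φ p.1))‖ ^ 2 - sInf S) atTop (𝓝 0) := by
      rw [← prod_atTop_atTop_eq, ← sub_self (sInf S)]
      exact (hDs.comp tendsto_fst).sub_const (sInf S)
    have hd2 : Tendsto (fun p : ℕ × ℕ => ‖D (v (φ p.2))‖ ^ 2 - sInf S) atTop (𝓝 0) := by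
      rw [← prod_atTop_atTop_eq, ← sub_self (sInf S)]
      exact (hDs.comp tendsto_snd).sub_const (sInf S)
    have hlim := ((hTc.add (((hd1.const_mul 2).add (hd2.const_mul 2)).add
      ((hTc.pow 2).const_mul (sInf S))).sqrt).const_mul |C|)
    simp only [mul_zero, add_zero, ne_eq, OfNat.ofNat_ne_zero, not_false_eq_true, zero_pow,
      Real.sqrt_zero] at hlim
    refine squeeze_zero (fun _ => dist_nonneg) (fun p => ?_) hlim
    rw [dist_eq_norm]
    refine (hC _).trans ?_
    refine (mul_le_mul_of_nonneg_right (le_abs_self C) (by positivity)).trans ?_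
    gcongr
    · simp [dist_eq_norm]
    · apply Real.le_sqrt_of_sq_le
      have := hkey _ (hvV (φ p.1)) _ (hvV (φ p.2)) (hvT _) (hvT _)
      simpa [dist_eq_norm] using this
  obtain ⟨w, hw⟩ := cauchySeq_tendsto_of_complete hcau
  refine ⟨w, hV.mem_of_tendsto hw (Eventually.of_forall fun n => hvV _), ?_, ?_⟩
  · have := ((T.continuous.tendsto w).comp hw).norm
    simp only [Function.comp_def, hvT] at this
    exact tendsto_nhds_unique this tendsto_const_nhds
  · have h1 : ‖D w‖ ^ 2 = sInf S :=
      tendsto_nhds_unique ((((D.continuous.tendsto w).comp hw).norm).pow 2) hDs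
    rw [h1]; exact hlow

/-- Along `w + t • v` the nonnegative quadratic ‖D ·‖² − c‖T ·‖² has no constant term, so its linear
coefficient vanishes: the Euler–Lagrange equation. -/
theorem inner_eq_mul_inner_of_forall_norm_sq_le {X F G : Type*}
    [NormedAddCommGroup X] [NormedSpace ℝ X]
    [NormedAddCommGroup F] [InnerProductSpace ℝ F]
    [NormedAddCommGroup G] [InnerProductSpace ℝ G]
    (T : X →L[ℝ] F) (D : X →L[ℝ] G) (V : Submodule ℝ X) {w : X} (hw : w ∈ V) {c : ℝ}
    (hwc : ‖D w‖ ^ 2 = c * ‖T w‖ ^ 2) (h : ∀ v ∈ V, c * ‖T v‖ ^ 2 ≤ ‖D v‖ ^ 2)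
    {v : X} (hv : v ∈ V) : inner ℝ (D w) (D v) = c * inner ℝ (T w) (T v) := by
  have hq : ∀ t : ℝ, 0 ≤ (‖D v‖ ^ 2 - c * ‖T v‖ ^ 2) * (t * t) +
      (2 * (inner ℝ (D w) (D v) - c * inner ℝ (T w) (T v))) * t + 0 := by
    intro t
    have := h (w + t • v) (V.add_mem hw (V.smul_mem t hv))
    simp only [map_add, map_smul, norm_add_sq_real, norm_smul, inner_smul_right, mul_pow,
      Real.norm_eq_abs, sq_abs] at this
    linarith
  have := discrim_le_zero hq
  rw [discrim] at this
  nlinarith [sq_nonneg (inner ℝ (D w) (D v) - c * inner ℝ (T w) (T v))]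

/-- The variational principle for the second eigenvalue of the form `‖D v‖²` with respect to
`‖T v‖²`, if `o` is an eigenvector for the lowest eigenvalue zero. -/
theorem IsCompactOperator.exists_inner_eq_mul_inner {X F G : Type*}
    [NormedAddCommGroup X] [NormedSpace ℝ X] [CompleteSpace X]
    [NormedAddCommGroup F] [InnerProductSpace ℝ F]
    [NormedAddCommGroup G] [InnerProductSpace ℝ G]
    {T : X →L[ℝ] F} (hT : IsCompactOperator T) (D : X →L[ℝ] G)
    {C : ℝ} (hC : ∀ v, ‖v‖ ≤ C * (‖T v‖ + ‖D v‖))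
    (V : Submodule ℝ X) (hV : IsClosed (V : Set X)) {o : X} (ho : o ∈ V) (hTo : T o ≠ 0)
    (hDo : D o = 0) (hne : ∃ v ∈ V, inner ℝ (T v) (T o) = (0 : ℝ) ∧ T v ≠ 0) :
    ∃ w ∈ V, ∃ c : ℝ, inner ℝ (T w) (T o) = (0 : ℝ) ∧ T w ≠ 0 ∧
      (∀ v ∈ V, inner ℝ (D w) (D v) = c * inner ℝ (T w) (T v)) ∧
      ∀ v ∈ V, inner ℝ (T v) (T o) = (0 : ℝ) → c * ‖T v‖ ^ 2 ≤ ‖D v‖ ^ 2 := by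
  set φ : X →L[ℝ] ℝ := (innerSL ℝ (T o)).comp T with hφ
  have hφa : ∀ v, inner ℝ (T v) (T o) = φ v := fun v => by
    rw [real_inner_comm]; rfl
  simp only [hφa] at hne ⊢
  obtain ⟨w, hwV, hw1, hmin⟩ := hT.exists_forall_norm_sq_le D hC
    (V ⊓ LinearMap.ker (φ : X →ₗ[ℝ] ℝ)) (hV.inter (isClosed_eq φ.continuous continuous_const))
    (by
      obtain ⟨v, h1, h2, h3⟩ := hne
      exact ⟨v, ⟨h1, h2⟩, h3⟩)
  have hw0 : φ w = 0 := hwV.2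
  have h1 : φ o ≠ 0 := by
    rw [← hφa]; exact inner_self_ne_zero.2 hTo
  refine ⟨w, hwV.1, ‖D w‖ ^ 2, hw0, ?_, fun v hv => ?_, fun v hv hv0 => hmin v ⟨hv, hv0⟩⟩
  · rw [← norm_ne_zero_iff, hw1]; exact one_ne_zero
  -- Minimality gives the equation only on the complement of `o`. Removing the component along `o`
  -- changes neither side, because `D o = 0` and `T w` is orthogonal to `T o`.
  · have hv' : v - (φ v / φ o) • o ∈ V ⊓ LinearMap.ker (φ : X →ₗ[ℝ] ℝ) := by
      refine ⟨Submodule.sub_mem _ hv (Submodule.smul_mem _ _ ho), ?_⟩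
      change φ (v - _) = 0
      rw [map_sub, map_smul, smul_eq_mul, div_mul_cancel₀ _ h1, sub_self]
    have := inner_eq_mul_inner_of_forall_norm_sq_le T D _ hwV (c := ‖D w‖ ^ 2)
      (by simp [hw1]) hmin hv'
    simp only [map_sub, map_smul, hDo, smul_zero, sub_zero, inner_sub_right, inner_smul_right,
      hφa w, hw0, mul_zero] at this
    exact this

/-! ### Compactness by the Arzelà–Ascoli theorem -/

section AffineFamily

variable {K H : Type*} [TopologicalSpace K] [CompactSpace K]
  [NormedAddCommGroup H] [InnerProductSpace ℝ H]

/-- The affine functions `x ↦ c + ⟪χ x, g⟫` on a compact space, depending linearly on `(c, g)`. -/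
noncomputable def affineFamily (χ : C(K, H)) : ℝ × H →L[ℝ] C(K, ℝ) :=
  LinearMap.mkContinuous
    { toFun := fun p => ⟨fun x => p.1 + inner ℝ (χ x) p.2, by fun_prop⟩
      map_add' := fun p q => by
        ext x; simp only [Prod.fst_add, Prod.snd_add, inner_add_right, ContinuousMap.coe_mk,
          ContinuousMap.add_apply]; ring
      map_smul' := fun r p => by
        ext x; simp [inner_smul_right, mul_add] }
    (1 + ‖χ‖) (fun p => by
      refine (ContinuousMap.norm_le _ (by positivity)).2 fun x => ?_
      simp only [LinearMap.coe_mk, AddHom.coe_mk, ContinuousMap.coe_mk]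
      calc ‖p.1 + inner ℝ (χ x) p.2‖ ≤ ‖p.1‖ + ‖χ x‖ * ‖p.2‖ :=
            (norm_add_le _ _).trans (by gcongr; exact norm_inner_le_norm _ _)
        _ ≤ ‖p‖ + ‖χ‖ * ‖p‖ := by
            gcongr
            · exact norm_fst_le p
            · exact χ.norm_coe_le_norm x
            · exact norm_snd_le p
        _ = _ := by ring)

theorem affineFamily_apply (χ : C(K, H)) (p : ℝ × H) (x : K) :
    affineFamily χ p x = p.1 + inner ℝ (χ x) p.2 := rfl

/-- On the unit ball, ‖χ x₀ − χ x‖ is a common modulus of continuity at x₀. -/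
theorem isCompactOperator_affineFamily (χ : C(K, H)) : IsCompactOperator (affineFamily χ) := by
  set Φ := (ContinuousMap.linearIsometryBoundedOfCompact K ℝ ℝ)
  have hcomp : IsCompact (closure ((fun p => Φ (affineFamily χ p)) '' Metric.ball 0 1)) := by
    refine BoundedContinuousFunction.arzela_ascoli (Metric.closedBall (0 : ℝ) (‖affineFamily χ‖))
      (isCompact_closedBall _ _) _ ?_ ?_
    · rintro _ x ⟨p, hp, rfl⟩
      rw [mem_closedBall_zero_iff]
      rw [mem_ball_zero_iff] at hp
      calc ‖Φ (affineFamily χ p) x‖ ≤ ‖Φ (affineFamily χ p)‖ :=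
            BoundedContinuousFunction.norm_coe_le_norm _ x
        _ = ‖affineFamily χ p‖ := Φ.norm_map _
        _ ≤ ‖affineFamily χ‖ * ‖p‖ := (affineFamily χ).le_opNorm p
        _ ≤ ‖affineFamily χ‖ := by
            nlinarith [norm_nonneg (affineFamily χ), norm_nonneg p]
    · intro x₀
      refine Metric.equicontinuousAt_of_continuity_modulus (fun x => ‖χ x₀ - χ x‖) ?_ _ ?_
      · have : Tendsto (fun x => ‖χ x₀ - χ x‖) (𝓝 x₀) (𝓝 ‖χ x₀ - χ x₀‖) :=
          (by fun_prop : Continuous fun x => ‖χ x₀ - χ x‖).tendsto x₀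
        simpa using this
      · refine Eventually.of_forall fun x => ?_
        rintro ⟨_, p, hp, rfl⟩
        rw [mem_ball_zero_iff] at hp
        change dist (affineFamily χ p x₀) (affineFamily χ p x) ≤ _
        rw [affineFamily_apply, affineFamily_apply, Real.dist_eq, add_sub_add_left_eq_sub,
          ← inner_sub_left]
        refine (abs_real_inner_le_norm _ _).trans ?_
        have := (norm_snd_le p).trans hp.le
        nlinarith [norm_nonneg (χ x₀ - χ x)]
  rw [isCompactOperator_iff_exists_mem_nhds_image_subset_compact]
  refine ⟨Metric.ball 0 1, Metric.ball_mem_nhds _ one_pos, _,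
    hcomp.image Φ.symm.continuous, ?_⟩
  rintro _ ⟨p, hp, rfl⟩
  exact ⟨_, subset_closure ⟨p, hp, rfl⟩, Φ.symm_apply_apply _⟩

end AffineFamily

/-! ### Sobolev functions on one interval -/

section Interval

/-- Square integrable functions on `(0, ℓ]`. -/
noncomputable abbrev IntervalL2 (ℓ : ℝ) := Lp ℝ 2 (volume.restrict (Ioc 0 ℓ))

theorem IntervalL2.intervalIntegrable {ℓ : ℝ} (hℓ : 0 ≤ ℓ) (g : IntervalL2 ℓ) :
    IntervalIntegrable g volume 0 ℓ := by
  rw [intervalIntegrable_iff_integrableOn_Ioc_of_le hℓ]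
  exact (Lp.memLp g).integrable (by norm_num)

/-- The indicator functions of the intervals `(0, x]`. -/
noncomputable def indicatorPath (ℓ : ℝ) : C(Icc (0 : ℝ) ℓ, IntervalL2 ℓ) where
  toFun x := indicatorConstLp 2 (measurableSet_Ioc (a := 0) (b := (x : ℝ)))
    (measure_ne_top _ _) (1 : ℝ)
  continuous_toFun := by
    refine continuous_indicatorConstLp_set (by norm_num) fun x => ?_
    have hlim : Tendsto (fun y : Icc (0 : ℝ) ℓ => ENNReal.ofReal |(y : ℝ) - x|) (𝓝 x) (𝓝 0) := by
      have : Tendsto (fun y : Icc (0 : ℝ) ℓ => ENNReal.ofReal |(y : ℝ) - x|) (𝓝 x)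
          (𝓝 (ENNReal.ofReal |(x : ℝ) - x|)) :=
        (ENNReal.continuous_ofReal.comp
          (by fun_prop : Continuous fun y : Icc (0 : ℝ) ℓ => |(y : ℝ) - x|)).tendsto x
      simpa using this
    refine tendsto_of_tendsto_of_tendsto_of_le_of_le tendsto_const_nhds hlim
      (fun _ => zero_le) fun y => ?_
    refine (Measure.restrict_apply_le _ _).trans ?_
    have hsub : symmDiff (Ioc (0 : ℝ) y) (Ioc 0 x) ⊆ uIoc (x : ℝ) y := by
      intro t ht
      simp only [mem_symmDiff, mem_Ioc, not_and, not_le, mem_uIoc] at ht ⊢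
      grind
    refine (measure_mono hsub).trans ?_
    rw [Real.volume_uIoc]

theorem inner_indicatorPath {ℓ : ℝ} (x : Icc (0 : ℝ) ℓ) (g : IntervalL2 ℓ) :
    inner ℝ (indicatorPath ℓ x) g = ∫ t in (0 : ℝ)..x, g t := by
  have h := L2.inner_indicatorConstLp_one (𝕜 := ℝ) (measurableSet_Ioc (a := 0) (b := (x : ℝ)))
    (measure_ne_top (volume.restrict (Ioc 0 ℓ)) _) g
  rw [intervalIntegral.integral_of_le x.2.1]
  refine h.trans ?_
  rw [Measure.restrict_restrict measurableSet_Ioc,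
    inter_eq_left.2 (Ioc_subset_Ioc_right x.2.2)]

/-- The Lebesgue measure on `[0, ℓ]`. -/
noncomputable abbrev intervalMeasure (ℓ : ℝ) : Measure (Icc (0 : ℝ) ℓ) :=
  Measure.comap Subtype.val volume

instance (ℓ : ℝ) : IsFiniteMeasure (intervalMeasure ℓ) :=
  ⟨by rw [intervalMeasure, comap_subtype_coe_apply measurableSet_Icc, image_univ,
    Subtype.range_coe]; exact measure_Icc_lt_top⟩

/-- The function with initial value `c` and derivative `g`. -/
noncomputable def primitive {ℓ : ℝ} (p : ℝ × IntervalL2 ℓ) (x : ℝ) : ℝ :=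
  p.1 + ∫ t in (0 : ℝ)..x, p.2 t

theorem primitive_const {ℓ : ℝ} (c : ℝ) {x : ℝ} (hx : x ∈ Icc 0 ℓ) :
    primitive (ℓ := ℓ) (c, 0) x = c := by
  rw [primitive, ← inner_indicatorPath ⟨x, hx⟩, inner_zero_right, add_zero]

/-- The operator that maps `(c, g)` to the square integrable function
with initial value `c` and derivative `g`. -/
noncomputable def primitiveL2 (ℓ : ℝ) :
    ℝ × IntervalL2 ℓ →L[ℝ] Lp ℝ 2 (intervalMeasure ℓ) :=
  (ContinuousMap.toLp 2 (intervalMeasure ℓ) ℝ).comp (affineFamily (indicatorPath ℓ))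

theorem isCompactOperator_primitiveL2 (ℓ : ℝ) : IsCompactOperator (primitiveL2 ℓ) :=
  (isCompactOperator_affineFamily (indicatorPath ℓ)).clm_comp
    (ContinuousMap.toLp 2 (intervalMeasure ℓ) ℝ)

theorem inner_primitiveL2 {ℓ : ℝ} (hℓ : 0 ≤ ℓ) (p q : ℝ × IntervalL2 ℓ) :
    inner ℝ (primitiveL2 ℓ p) (primitiveL2 ℓ q) =
      ∫ x in (0 : ℝ)..ℓ, primitive p x * primitive q x := by
  rw [primitiveL2, ContinuousLinearMap.comp_apply, ContinuousLinearMap.comp_apply,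
    ContinuousMap.inner_toLp, intervalIntegral.integral_of_le hℓ, ← integral_Icc_eq_integral_Ioc,
    ← integral_subtype_comap measurableSet_Icc]
  refine integral_congr_ae (Eventually.of_forall fun x => ?_)
  simp only [affineFamily_apply, inner_indicatorPath, primitive, conj_trivial]
  ring

theorem inner_intervalL2 {ℓ : ℝ} (hℓ : 0 ≤ ℓ) (g h : IntervalL2 ℓ) :
    inner ℝ g h = ∫ x in (0 : ℝ)..ℓ, g x * h x := by
  rw [L2.inner_def, intervalIntegral.integral_of_le hℓ]
  simp [mul_comm]

/-- Only the initial value needs a bound: `p.1 • T (1, 0) = T p - T (0, p.2)`, and the constant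
function 1 has nonzero norm. -/
theorem primitiveL2_coercive {ℓ : ℝ} (hℓ : 0 < ℓ) :
    ∃ C, 0 ≤ C ∧ ∀ p, ‖p‖ ≤ C * (‖primitiveL2 ℓ p‖ + ‖p.2‖) := by
  set T := primitiveL2 ℓ
  have h1 : 0 < ‖T (1, 0)‖ := by
    rw [norm_pos_iff, ne_eq, ← inner_self_eq_zero (𝕜 := ℝ), inner_primitiveL2 hℓ.le]
    have h : ∫ x in (0 : ℝ)..ℓ, primitive (ℓ := ℓ) (1, 0) x * primitive (ℓ := ℓ) (1, 0) x = ℓ := by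
      rw [intervalIntegral.integral_congr (g := fun _ => (1 : ℝ)) fun x hx => ?_]
      · simp
      · rw [uIcc_of_le hℓ.le] at hx
        simp [primitive_const 1 hx]
    rw [h]
    exact hℓ.ne'
  refine ⟨1 + (1 + ‖T‖) / ‖T (1, 0)‖, by positivity, fun p => ?_⟩
  have h2 : |p.1| * ‖T (1, 0)‖ ≤ ‖T p‖ + ‖T‖ * ‖p.2‖ := by
    have : p.1 • T (1, 0) = T p - T (0, p.2) := by
      rw [← map_smul, ← map_sub]; congr 1; ext <;> simp
    rw [← Real.norm_eq_abs, ← norm_smul, this]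
    refine (norm_sub_le _ _).trans ?_
    gcongr
    refine (T.le_opNorm _).trans ?_
    simp [Prod.norm_def]
  have h3 : |p.1| ≤ (1 + ‖T‖) / ‖T (1, 0)‖ * (‖T p‖ + ‖p.2‖) := by
    rw [div_mul_eq_mul_div, le_div_iff₀ h1]
    nlinarith [norm_nonneg (T p), norm_nonneg p.2, norm_nonneg T]
  have h4 : 0 ≤ (1 + ‖T‖) / ‖T (1, 0)‖ * (‖T p‖ + ‖p.2‖) := by positivity
  rw [Prod.norm_def, Real.norm_eq_abs]
  refine max_le ?_ ?_ <;> nlinarith [norm_nonneg (T p), norm_nonneg p.2]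

end Interval

/-! ### Integration by parts and the du Bois-Reymond lemma -/

/-- `F` is an absolutely continuous function on `[0, ℓ]` with derivative `f`. -/
structure IsPrimitive (ℓ : ℝ) (F f : ℝ → ℝ) : Prop where
  intervalIntegrable : IntervalIntegrable f volume 0 ℓ
  eq_add_integral : ∀ x ∈ Icc 0 ℓ, F x = F 0 + ∫ t in (0 : ℝ)..x, f t

namespace IsPrimitive

variable {ℓ : ℝ} {F f G g : ℝ → ℝ}

theorem continuousOn (hℓ : 0 ≤ ℓ) (h : IsPrimitive ℓ F f) : ContinuousOn F (Icc 0 ℓ) := by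
  have := intervalIntegral.continuousOn_primitive_interval' h.intervalIntegrable left_mem_uIcc
  rw [uIcc_of_le hℓ] at this
  exact (continuousOn_const.add this).congr h.eq_add_integral

theorem intervalIntegrable_self (hℓ : 0 ≤ ℓ) (h : IsPrimitive ℓ F f) :
    IntervalIntegrable F volume 0 ℓ := by
  refine ContinuousOn.intervalIntegrable ?_
  rw [uIcc_of_le hℓ]; exact h.continuousOn hℓ

theorem intervalIntegrable_mul (hℓ : 0 ≤ ℓ) (hF : IsPrimitive ℓ F f)
    (hg : IntervalIntegrable g volume 0 ℓ) :
    IntervalIntegrable (fun x => F x * g x) volume 0 ℓ :=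
  hg.continuousOn_mul (by rw [uIcc_of_le hℓ]; exact hF.continuousOn hℓ)

/-- `F` and `G` are known only on `[0, ℓ]`, so the parts formula is applied to the explicit
primitives, whose derivatives are `f` and `g` almost everywhere. -/
theorem integral_mul (hℓ : 0 ≤ ℓ) (hF : IsPrimitive ℓ F f) (hG : IsPrimitive ℓ G g) :
    ∫ x in (0 : ℝ)..ℓ, F x * g x = F ℓ * G ℓ - F 0 * G 0 - ∫ x in (0 : ℝ)..ℓ, f x * G x := by
  have hac : ∀ {F f : ℝ → ℝ}, IsPrimitive ℓ F f →
      AbsolutelyContinuousOnInterval (fun x => F 0 + ∫ t in (0 : ℝ)..x, f t) 0 ℓ := by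
    intro F f h
    have h1 := h.intervalIntegrable.absolutelyContinuousOnInterval_intervalIntegral
      (c := 0) left_mem_uIcc
    have h2 : AbsolutelyContinuousOnInterval (fun _ : ℝ => F 0) 0 ℓ :=
      (LipschitzWith.const (F 0)).lipschitzOnWith.absolutelyContinuousOnInterval
    exact h2.add h1
  have hder : ∀ {F f : ℝ → ℝ}, IsPrimitive ℓ F f → ∀ᵐ x, x ∈ uIcc 0 ℓ →
      deriv (fun x => F 0 + ∫ t in (0 : ℝ)..x, f t) x = f x := by
    intro F f h
    filter_upwards [h.intervalIntegrable.ae_hasDerivAt_integral] with x hx hx'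
    exact ((hx hx' 0 left_mem_uIcc).const_add (F 0)).deriv
  have key := (hac hF).integral_mul_deriv_eq_deriv_mul (hac hG)
  have e1 : ∀ x ∈ uIcc 0 ℓ, F x = F 0 + ∫ t in (0 : ℝ)..x, f t := by
    rw [uIcc_of_le hℓ]; exact hF.eq_add_integral
  have e2 : ∀ x ∈ uIcc 0 ℓ, G x = G 0 + ∫ t in (0 : ℝ)..x, g t := by
    rw [uIcc_of_le hℓ]; exact hG.eq_add_integral
  rw [← e1 ℓ right_mem_uIcc, ← e1 0 left_mem_uIcc, ← e2 ℓ right_mem_uIcc,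
    ← e2 0 left_mem_uIcc] at key
  have c1 : ∫ x in (0 : ℝ)..ℓ, F x * g x = ∫ x in (0 : ℝ)..ℓ, (F 0 + ∫ t in (0 : ℝ)..x, f t) *
      deriv (fun x => G 0 + ∫ t in (0 : ℝ)..x, g t) x := by
    refine intervalIntegral.integral_congr_ae ?_
    filter_upwards [hder hG] with x hx hx'
    rw [hx (uIoc_subset_uIcc hx'), ← e1 x (uIoc_subset_uIcc hx')]
  have c2 : ∫ x in (0 : ℝ)..ℓ, f x * G x = ∫ x in (0 : ℝ)..ℓ,
      deriv (fun x => F 0 + ∫ t in (0 : ℝ)..x, f t) x * (G 0 + ∫ t in (0 : ℝ)..x, g t) := by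
    refine intervalIntegral.integral_congr_ae ?_
    filter_upwards [hder hF] with x hx hx'
    rw [hx (uIoc_subset_uIcc hx'), ← e2 x (uIoc_subset_uIcc hx')]
  rw [c1, c2, key]

theorem of_hasDerivAt (hF : ∀ x, HasDerivAt F (f x) x) (hf : Continuous f) :
    IsPrimitive ℓ F f where
  intervalIntegrable := hf.intervalIntegrable _ _
  eq_add_integral x _ := by
    rw [intervalIntegral.integral_eq_sub_of_hasDerivAt (fun x _ => hF x)
      (hf.intervalIntegrable _ _)]; ring

theorem intervalIntegral (c : ℝ) (hf : IntervalIntegrable f volume 0 ℓ) :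
    IsPrimitive ℓ (fun x => c + ∫ t in (0 : ℝ)..x, f t) f :=
  ⟨hf, fun x _ => by simp⟩

theorem memLp (hℓ : 0 ≤ ℓ) (h : IsPrimitive ℓ F f) : MemLp F 2 (volume.restrict (Ioc 0 ℓ)) := by
  have hc := h.continuousOn hℓ
  obtain ⟨C, hC⟩ := isCompact_Icc.exists_bound_of_continuousOn hc
  refine MemLp.of_bound ((hc.mono Ioc_subset_Icc_self).aestronglyMeasurable measurableSet_Ioc) C ?_
  filter_upwards [ae_restrict_mem measurableSet_Ioc] with x hx
  exact hC x (Ioc_subset_Icc_self hx)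

end IsPrimitive

theorem primitive_zero {ℓ : ℝ} (p : ℝ × IntervalL2 ℓ) : primitive p 0 = p.1 := by
  simp [primitive]

theorem isPrimitive_primitive {ℓ : ℝ} (hℓ : 0 ≤ ℓ) (p : ℝ × IntervalL2 ℓ) :
    IsPrimitive ℓ (primitive p) p.2 :=
  IsPrimitive.intervalIntegral p.1 (IntervalL2.intervalIntegrable hℓ p.2)

theorem intervalIntegral_congr_ae_restrict {ℓ : ℝ} {f g : ℝ → ℝ}
    (h : f =ᵐ[volume.restrict (Ioc 0 ℓ)] g) {x : ℝ} (hx : x ∈ Icc 0 ℓ) :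
    ∫ t in (0 : ℝ)..x, f t = ∫ t in (0 : ℝ)..x, g t := by
  rw [intervalIntegral.integral_of_le hx.1, intervalIntegral.integral_of_le hx.1]
  exact integral_congr_ae (ae_restrict_of_ae_restrict_of_subset (Ioc_subset_Ioc_right hx.2) h)

/-- The du Bois-Reymond lemma for the equation `-u'' = c u` on an interval. -/
theorem exists_ae_eq_sub_integral {ℓ : ℝ} (hℓ : 0 < ℓ) (p : ℝ × IntervalL2 ℓ) (c : ℝ)
    (h : ∀ g : IntervalL2 ℓ, ∫ x in (0 : ℝ)..ℓ, g x = 0 →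
      ∫ x in (0 : ℝ)..ℓ, p.2 x * g x =
        c * ∫ x in (0 : ℝ)..ℓ, primitive p x * primitive (0, g) x) :
    ∃ κ : ℝ, p.2 =ᵐ[volume.restrict (Ioc 0 ℓ)]
      fun x => κ + ∫ t in (0 : ℝ)..x, -c * primitive p t := by
  have hp := isPrimitive_primitive hℓ.le p
  have hpi : IntervalIntegrable (fun t => -c * primitive p t) volume 0 ℓ :=
    (hp.intervalIntegrable_self hℓ.le).const_mul _
  set U : ℝ → ℝ := fun x => ∫ t in (0 : ℝ)..x, -c * primitive p t with hU
  have hUp : IsPrimitive ℓ U (fun t => -c * primitive p t) := ⟨hpi, fun x _ => by simp [hU]⟩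
  -- The mean of `p.2 - U`, so that `g` below has integral zero and is an admissible test function;
  -- testing with it gives ‖g‖² = 0.
  set κ : ℝ := (∫ x in (0 : ℝ)..ℓ, (p.2 x - U x)) / ℓ with hκ
  have hmem : MemLp (fun x => p.2 x - U x - κ) 2 (volume.restrict (Ioc 0 ℓ)) :=
    ((Lp.memLp p.2).sub (hUp.memLp hℓ.le)).sub (memLp_const κ)
  set g : IntervalL2 ℓ := hmem.toLp with hg
  have hgae : g =ᵐ[volume.restrict (Ioc 0 ℓ)] fun x => p.2 x - U x - κ := hmem.coeFn_toLp
  have hℓm : ℓ ∈ Icc 0 ℓ := ⟨hℓ.le, le_rfl⟩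
  have hUi := hUp.intervalIntegrable_self hℓ.le
  have hp2i := IntervalL2.intervalIntegrable hℓ.le p.2
  have hg0 : ∫ x in (0 : ℝ)..ℓ, g x = 0 := by
    rw [intervalIntegral_congr_ae_restrict hgae hℓm, intervalIntegral.integral_sub
      (hp2i.sub hUi) intervalIntegrable_const, intervalIntegral.integral_const, hκ]
    simp only [smul_eq_mul, sub_zero]
    field_simp
    ring
  have hv := isPrimitive_primitive hℓ.le ((0, g) : ℝ × IntervalL2 ℓ)
  have hvℓ : primitive ((0, g) : ℝ × IntervalL2 ℓ) ℓ = 0 := by simp [primitive, hg0]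
  have hibp := hUp.integral_mul hℓ.le hv
  rw [hvℓ, primitive_zero] at hibp
  simp only [mul_zero, sub_zero, zero_sub, mul_assoc,
    intervalIntegral.integral_const_mul] at hibp
  have hgg : inner ℝ g g = (0 : ℝ) := by
    rw [inner_intervalL2 hℓ.le]
    have e1 : (fun x => g x * g x) =ᵐ[volume.restrict (Ioc 0 ℓ)]
        fun x => p.2 x * g x - U x * g x - κ * g x := by
      filter_upwards [hgae] with x hx
      nth_rw 1 [hx]; ring
    have hgi := IntervalL2.intervalIntegrable hℓ.le g
    have hpg : IntervalIntegrable (fun x => p.2 x * g x) volume 0 ℓ := by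
      rw [intervalIntegrable_iff_integrableOn_Ioc_of_le hℓ.le]
      exact (Lp.memLp p.2).integrable_mul (Lp.memLp g)
    have hUg := hUp.intervalIntegrable_mul hℓ.le hgi
    rw [intervalIntegral_congr_ae_restrict e1 hℓm, intervalIntegral.integral_sub
      (hpg.sub hUg) (hgi.const_mul _), intervalIntegral.integral_sub hpg hUg,
      intervalIntegral.integral_const_mul, hg0, h g hg0, hibp]
    ring
  rw [inner_self_eq_zero] at hgg
  refine ⟨κ, ?_⟩
  have h0 : g =ᵐ[volume.restrict (Ioc 0 ℓ)] 0 := by rw [hgg]; exact Lp.coeFn_zero _ _ _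
  filter_upwards [hgae, h0] with x h1 h2
  rw [h2, Pi.zero_apply] at h1
  change p.2 x = κ + U x
  linarith

/-! ### The form domain of a graph and weak eigenfunctions -/

namespace MetricGraph

variable {E : Type u}

/-- Pairs of initial values and square integrable derivatives on the edges. They represent the
functions that belong to `W₂¹` on every edge. -/
abbrev EdgeSobolev (Γ : MetricGraph E) : Type u := ∀ e : E, ℝ × IntervalL2 (Γ.len e)

/-- The continuous functions represented by an element of the edgewise Sobolev space. -/
noncomputable def toFunc (Γ : MetricGraph E) (v : Γ.EdgeSobolev) : Γ.Func :=
  fun e x => primitive (v e) x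

theorem toFunc_apply (Γ : MetricGraph E) (v : Γ.EdgeSobolev) (e : E) (x : Icc (0 : ℝ) (Γ.len e)) :
    Γ.toFunc v e x = primitive (v e) x := rfl

theorem toFunc_eq_affineFamily (Γ : MetricGraph E) (v : Γ.EdgeSobolev) (e : E)
    (x : Icc (0 : ℝ) (Γ.len e)) :
    Γ.toFunc v e x = affineFamily (indicatorPath (Γ.len e)) (v e) x := by
  rw [affineFamily_apply, inner_indicatorPath]; rfl

theorem endValue_false (Γ : MetricGraph E) (v : Γ.EdgeSobolev) (e : E) :
    Γ.endValue (Γ.toFunc v) (e, false) = primitive (v e) 0 := by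
  simp [endValue, endPoint, toFunc_apply]

theorem endValue_true (Γ : MetricGraph E) (v : Γ.EdgeSobolev) (e : E) :
    Γ.endValue (Γ.toFunc v) (e, true) = primitive (v e) (Γ.len e) := by
  simp [endValue, endPoint, toFunc_apply]

/-- The evaluation at an end point. -/
noncomputable def endEval (Γ : MetricGraph E) (p : E × Bool) : Γ.EdgeSobolev →L[ℝ] ℝ :=
  (ContinuousMap.evalCLM ℝ (Γ.endPoint p)).comp
    ((affineFamily (indicatorPath (Γ.len p.1))).comp (ContinuousLinearMap.proj p.1))

theorem endEval_apply (Γ : MetricGraph E) (p : E × Bool) (v : Γ.EdgeSobolev) :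
    Γ.endEval p v = Γ.endValue (Γ.toFunc v) p :=
  (Γ.toFunc_eq_affineFamily v p.1 (Γ.endPoint p)).symm

/-- The functions that are continuous at the vertices. -/
noncomputable def vertexContinuous (Γ : MetricGraph E) : Submodule ℝ Γ.EdgeSobolev where
  carrier := {v | ∀ p q, Γ.glue p q → Γ.endEval p v = Γ.endEval q v}
  add_mem' hv hw p q h := by rw [map_add, map_add, hv p q h, hw p q h]
  zero_mem' p q _ := by rw [map_zero, map_zero]
  smul_mem' c v hv p q h := by rw [map_smul, map_smul, hv p q h]

theorem mem_vertexContinuous {Γ : MetricGraph E} {v : Γ.EdgeSobolev} :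
    v ∈ Γ.vertexContinuous ↔
      ∀ p q, Γ.glue p q → Γ.endValue (Γ.toFunc v) p = Γ.endValue (Γ.toFunc v) q := by
  simp only [← endEval_apply]; rfl

theorem isClosed_vertexContinuous (Γ : MetricGraph E) :
    IsClosed (Γ.vertexContinuous : Set Γ.EdgeSobolev) := by
  have : (Γ.vertexContinuous : Set Γ.EdgeSobolev) =
      ⋂ (p) (q) (_ : Γ.glue p q), {v | Γ.endEval p v = Γ.endEval q v} := by
    ext v; simp only [mem_iInter]; rfl
  rw [this]
  exact isClosed_iInter fun p => isClosed_iInter fun q => isClosed_iInter fun _ =>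
    isClosed_eq (Γ.endEval p).continuous (Γ.endEval q).continuous

/-- The constant function `1`. -/
noncomputable def oneSobolev (Γ : MetricGraph E) : Γ.EdgeSobolev := fun _ => (1, 0)

theorem primitive_oneSobolev (Γ : MetricGraph E) {e : E} {x : ℝ} (hx : x ∈ Icc 0 (Γ.len e)) :
    primitive (Γ.oneSobolev e) x = 1 := primitive_const 1 hx

theorem toFunc_oneSobolev (Γ : MetricGraph E) : Γ.toFunc Γ.oneSobolev = fun _ _ => 1 := by
  funext e x
  exact primitive_const 1 x.2

theorem oneSobolev_mem (Γ : MetricGraph E) : Γ.oneSobolev ∈ Γ.vertexContinuous := by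
  rw [mem_vertexContinuous, toFunc_oneSobolev]
  intros; rfl

/-- The embedding of the edgewise Sobolev space into `L₂(Γ)`. -/
noncomputable def toL2 (Γ : MetricGraph E) :
    Γ.EdgeSobolev →L[ℝ] PiLp 2 fun e => Lp ℝ 2 (intervalMeasure (Γ.len e)) :=
  (PiLp.continuousLinearEquiv 2 ℝ _).symm.toContinuousLinearMap.comp
    (ContinuousLinearMap.pi fun e => (primitiveL2 (Γ.len e)).comp (ContinuousLinearMap.proj e))

theorem toL2_apply (Γ : MetricGraph E) (v : Γ.EdgeSobolev) (e : E) :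
    Γ.toL2 v e = primitiveL2 (Γ.len e) (v e) := rfl

/-- The derivative as a map from the edgewise Sobolev space to `L₂(Γ)`. -/
noncomputable def derivL2 (Γ : MetricGraph E) :
    Γ.EdgeSobolev →L[ℝ] PiLp 2 fun e => IntervalL2 (Γ.len e) :=
  (PiLp.continuousLinearEquiv 2 ℝ _).symm.toContinuousLinearMap.comp
    (ContinuousLinearMap.pi fun e =>
      (ContinuousLinearMap.snd ℝ ℝ (IntervalL2 (Γ.len e))).comp (ContinuousLinearMap.proj e))

theorem derivL2_apply (Γ : MetricGraph E) (v : Γ.EdgeSobolev) (e : E) :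
    Γ.derivL2 v e = (v e).2 := rfl

theorem derivL2_oneSobolev (Γ : MetricGraph E) : Γ.derivL2 Γ.oneSobolev = 0 := by
  ext1 e; rfl

variable [Fintype E]

theorem inner_toL2 (Γ : MetricGraph E) (v w : Γ.EdgeSobolev) :
    inner ℝ (Γ.toL2 v) (Γ.toL2 w) =
      ∑ e, ∫ x in (0 : ℝ)..Γ.len e, primitive (v e) x * primitive (w e) x := by
  rw [PiLp.inner_apply]
  exact Finset.sum_congr rfl fun e _ => inner_primitiveL2 (Γ.len_pos e).le _ _

theorem inner_derivL2 (Γ : MetricGraph E) (v w : Γ.EdgeSobolev) :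
    inner ℝ (Γ.derivL2 v) (Γ.derivL2 w) =
      ∑ e, ∫ x in (0 : ℝ)..Γ.len e, (v e).2 x * (w e).2 x := by
  rw [PiLp.inner_apply]
  exact Finset.sum_congr rfl fun e _ => inner_intervalL2 (Γ.len_pos e).le _ _

theorem isCompactOperator_toL2 (Γ : MetricGraph E) : IsCompactOperator Γ.toL2 := by
  refine IsCompactOperator.clm_comp (f := ContinuousLinearMap.pi fun e =>
    (primitiveL2 (Γ.len e)).comp (ContinuousLinearMap.proj (φ := fun e =>
      ℝ × IntervalL2 (Γ.len e)) e)) ?_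
    (PiLp.continuousLinearEquiv 2 ℝ _).symm.toContinuousLinearMap
  have h := fun e => isCompactOperator_primitiveL2 (Γ.len e)
  choose K hK hK0 using h
  refine ⟨Set.pi univ K, isCompact_univ_pi hK, ?_⟩
  have : Set.pi univ (fun e => primitiveL2 (Γ.len e) ⁻¹' K e) ∈ 𝓝 (0 : Γ.EdgeSobolev) :=
    set_pi_mem_nhds finite_univ fun e _ => hK0 e
  exact this

theorem toL2_coercive (Γ : MetricGraph E) :
    ∃ C, ∀ v, ‖v‖ ≤ C * (‖Γ.toL2 v‖ + ‖Γ.derivL2 v‖) := by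
  choose C hC0 hC using fun e => primitiveL2_coercive (Γ.len_pos e)
  refine ⟨∑ e, C e, fun v => ?_⟩
  refine (pi_norm_le_iff_of_nonneg ?_).2 fun e => ?_
  · have : 0 ≤ ∑ e, C e := Finset.sum_nonneg fun e _ => hC0 e
    positivity
  refine (hC e (v e)).trans ?_
  gcongr
  · exact Finset.sum_nonneg fun e _ => hC0 e
  · exact Finset.single_le_sum (fun e _ => hC0 e) (Finset.mem_univ e)
  · exact PiLp.norm_apply_le (Γ.toL2 v) e
  · exact PiLp.norm_apply_le (Γ.derivL2 v) e

theorem inner_toL2_oneSobolev (Γ : MetricGraph E) (v : Γ.EdgeSobolev) :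
    inner ℝ (Γ.toL2 v) (Γ.toL2 Γ.oneSobolev) = ∑ e, ∫ x in (0 : ℝ)..Γ.len e, primitive (v e) x := by
  rw [inner_toL2]
  refine Finset.sum_congr rfl fun e _ => intervalIntegral.integral_congr fun x hx => ?_
  rw [uIcc_of_le (Γ.len_pos e).le] at hx
  simp only [Γ.primitive_oneSobolev hx, mul_one]

theorem inner_toL2_one_one (Γ : MetricGraph E) :
    inner ℝ (Γ.toL2 Γ.oneSobolev) (Γ.toL2 Γ.oneSobolev) = Γ.totalLength := by
  rw [inner_toL2_oneSobolev, totalLength]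
  refine Finset.sum_congr rfl fun e _ => ?_
  rw [intervalIntegral.integral_congr (g := fun _ => (1 : ℝ)) fun x hx => ?_]
  · simp
  · rw [uIcc_of_le (Γ.len_pos e).le] at hx
    exact Γ.primitive_oneSobolev hx

theorem totalLength_pos (Γ : MetricGraph E) [Nonempty E] : 0 < Γ.totalLength :=
  Finset.sum_pos (fun e _ => Γ.len_pos e) Finset.univ_nonempty

/-- The first excited eigenvalue in the weak formulation, by minimizing the Rayleigh quotient. -/
theorem exists_weak_eigenfunction (Γ : MetricGraph E) [Nonempty E]
    (hne : ∃ v ∈ Γ.vertexContinuous, inner ℝ (Γ.toL2 v) (Γ.toL2 Γ.oneSobolev) = (0 : ℝ) ∧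
      Γ.toL2 v ≠ 0) :
    ∃ w ∈ Γ.vertexContinuous, ∃ c : ℝ,
      inner ℝ (Γ.toL2 w) (Γ.toL2 Γ.oneSobolev) = (0 : ℝ) ∧ Γ.toL2 w ≠ 0 ∧
      (∀ v ∈ Γ.vertexContinuous, inner ℝ (Γ.derivL2 w) (Γ.derivL2 v) =
        c * inner ℝ (Γ.toL2 w) (Γ.toL2 v)) ∧
      ∀ v ∈ Γ.vertexContinuous, inner ℝ (Γ.toL2 v) (Γ.toL2 Γ.oneSobolev) = (0 : ℝ) →
        c * ‖Γ.toL2 v‖ ^ 2 ≤ ‖Γ.derivL2 v‖ ^ 2 := by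
  obtain ⟨C, hC⟩ := Γ.toL2_coercive
  refine Γ.isCompactOperator_toL2.exists_inner_eq_mul_inner Γ.derivL2 hC _
    Γ.isClosed_vertexContinuous Γ.oneSobolev_mem ?_ Γ.derivL2_oneSobolev hne
  rw [← inner_self_ne_zero (𝕜 := ℝ), inner_toL2_one_one]
  exact Γ.totalLength_pos.ne'

end MetricGraph

/-! ### Weak and strong solutions -/

open scoped Classical in
theorem Setoid.sum_mul_eq_zero {α : Type*} [Fintype α] (s : Setoid α) {f g : α → ℝ}
    (hg : ∀ p q, s p q → g p = g q) (hf : ∀ p, ∑ q with s p q, f q = 0) :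
    ∑ p, f p * g p = 0 := by
  rw [← Finset.sum_fiberwise Finset.univ (fun p => (Quotient.mk s p)) (fun p => f p * g p)]
  refine Finset.sum_eq_zero fun j _ => ?_
  induction j using Quotient.inductionOn with
  | h p =>
    have h1 : (Finset.univ.filter fun q => Quotient.mk s q = Quotient.mk s p) =
        Finset.univ.filter fun q => s p q := by
      ext q
      simp only [Finset.mem_filter, Finset.mem_univ, true_and]
      rw [Quotient.eq]
      exact ⟨fun h => s.symm h, fun h => s.symm h⟩
    rw [h1]
    calc ∑ q with s p q, f q * g q = ∑ q with s p q, f q * g p := by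
          refine Finset.sum_congr rfl fun q hq => ?_
          rw [hg p q (Finset.mem_filter.1 hq).2]
      _ = 0 := by rw [← Finset.sum_mul, hf, zero_mul]

theorem IsPrimitive.of_isSobolev22 {ℓ : ℝ} (hℓ : 0 ≤ ℓ) {u : Icc (0 : ℝ) ℓ → ℝ} {du ddu : ℝ → ℝ}
    (h : MetricGraph.IsSobolev22 ℓ u du ddu) : IsPrimitive ℓ du ddu where
  intervalIntegrable := by
    rw [intervalIntegrable_iff_integrableOn_Ioc_of_le hℓ]
    exact (h.memLp.integrable (by norm_num)).mono_measure
      (Measure.restrict_mono Ioc_subset_Icc_self le_rfl)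
  eq_add_integral x hx := by
    rw [← h.integral_ddu 0 ⟨le_rfl, hℓ⟩ x hx]; ring

namespace MetricGraph

variable {E : Type u}

/-- The bridge from the Sobolev data in the definitions to pairs (initial value, derivative); the
almost everywhere equation becomes an integral equation for `du`. -/
theorem exists_primitive_eq_of_isSobolev22 {ℓ lam : ℝ} (hℓ : 0 ≤ ℓ) {u : Icc (0 : ℝ) ℓ → ℝ}
    {du ddu : ℝ → ℝ} (h : IsSobolev22 ℓ u du ddu)
    (heq : ∀ᵐ x : ℝ, ∀ hx : x ∈ Icc 0 ℓ, -ddu x = lam * u ⟨x, hx⟩) :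
    ∃ p : ℝ × IntervalL2 ℓ, (∀ x : Icc (0 : ℝ) ℓ, primitive p x = u x) ∧
      p.2 =ᵐ[volume.restrict (Ioc 0 ℓ)] du ∧
      IsPrimitive ℓ du fun x => -lam * primitive p x := by
  have hdu := IsPrimitive.of_isSobolev22 hℓ h
  have hae := (hdu.memLp hℓ).coeFn_toLp
  have hp : ∀ x : Icc (0 : ℝ) ℓ,
      primitive ((u ⟨0, le_rfl, hℓ⟩, (hdu.memLp hℓ).toLp) : ℝ × IntervalL2 ℓ) x = u x := by
    intro x
    rw [primitive, intervalIntegral_congr_ae_restrict hae x.2, ← h.integral_du ⟨0, le_rfl, hℓ⟩ x]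
    ring
  refine ⟨(u ⟨0, le_rfl, hℓ⟩, (hdu.memLp hℓ).toLp), hp, hae, ?_, fun x hx => ?_⟩
  · exact ((isPrimitive_primitive hℓ _).intervalIntegrable_self hℓ).const_mul _
  · rw [hdu.eq_add_integral x hx]
    congr 1
    refine intervalIntegral_congr_ae_restrict ?_ hx
    rw [EventuallyEq, ae_restrict_iff' measurableSet_Ioc]
    filter_upwards [heq] with t ht ht'
    have h1 := ht (Ioc_subset_Icc_self ht')
    rw [← hp] at h1
    linarith

variable [Fintype E]

open scoped Classical in
/-- The function represented by `v` solves `-v'' = lam * v` on the edges, with derivative `du`,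
and satisfies the standard matching conditions. -/
structure IsSolution (Γ : MetricGraph E) (lam : ℝ) (v : Γ.EdgeSobolev) (du : E → ℝ → ℝ) :
    Prop where
  mem : v ∈ Γ.vertexContinuous
  ae_eq : ∀ e, (v e).2 =ᵐ[volume.restrict (Ioc 0 (Γ.len e))] du e
  isPrimitive : ∀ e, IsPrimitive (Γ.len e) (du e) fun x => -lam * primitive (v e) x
  kirchhoff : ∀ p : E × Bool, ∑ q : E × Bool with Γ.glue p q, Γ.normalDeriv du q = 0

theorem IsEigenfunction.exists_isSolution {Γ : MetricGraph E} {lam : ℝ} {ψ : Γ.Func}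
    (h : Γ.IsEigenfunction lam ψ) : ∃ v du, Γ.toFunc v = ψ ∧ Γ.IsSolution lam v du := by
  obtain ⟨-, du, ddu, hdom, heq⟩ := h
  choose v hv hae hprim using fun e =>
    exists_primitive_eq_of_isSobolev22 (Γ.len_pos e).le (hdom.sobolev e) (heq e)
  have hψ : Γ.toFunc v = ψ := by funext e x; exact hv e x
  refine ⟨v, du, hψ, ?_, hae, hprim, hdom.kirchhoff⟩
  rw [mem_vertexContinuous, hψ]
  exact hdom.continuous_vertex

theorem sum_boundary (Γ : MetricGraph E) (du : E → ℝ → ℝ) (z : Γ.EdgeSobolev) :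
    ∑ p, Γ.normalDeriv du p * Γ.endValue (Γ.toFunc z) p =
      -∑ e, (du e (Γ.len e) * primitive (z e) (Γ.len e) - du e 0 * primitive (z e) 0) := by
  rw [Fintype.sum_prod_type, ← Finset.sum_neg_distrib]
  refine Finset.sum_congr rfl fun e _ => ?_
  rw [Fintype.sum_bool, endValue_true, endValue_false]
  simp only [normalDeriv, if_true, Bool.false_eq_true, if_false]
  ring

theorem integral_deriv_mul {ℓ lam : ℝ} (hℓ : 0 ≤ ℓ) {p : ℝ × IntervalL2 ℓ} {du : ℝ → ℝ}
    (hae : p.2 =ᵐ[volume.restrict (Ioc 0 ℓ)] du)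
    (hprim : IsPrimitive ℓ du fun x => -lam * primitive p x) (z : ℝ × IntervalL2 ℓ) :
    ∫ x in (0 : ℝ)..ℓ, p.2 x * z.2 x = du ℓ * primitive z ℓ - du 0 * primitive z 0 +
      lam * ∫ x in (0 : ℝ)..ℓ, primitive p x * primitive z x := by
  have h1 : (fun x => p.2 x * z.2 x) =ᵐ[volume.restrict (Ioc 0 ℓ)] fun x => du x * z.2 x := by
    filter_upwards [hae] with x hx; rw [hx]
  rw [intervalIntegral_congr_ae_restrict h1 ⟨hℓ, le_rfl⟩,
    hprim.integral_mul hℓ (isPrimitive_primitive hℓ z)]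
  simp only [mul_assoc, intervalIntegral.integral_const_mul]
  ring

/-- Integration by parts edge by edge, with no vertex condition on either function. It yields the
weak equation for solutions and, conversely, isolates the vertex sums of a weak solution. -/
theorem inner_derivL2_eq (Γ : MetricGraph E) {lam : ℝ} {v : Γ.EdgeSobolev} {du : E → ℝ → ℝ}
    (hae : ∀ e, (v e).2 =ᵐ[volume.restrict (Ioc 0 (Γ.len e))] du e)
    (hprim : ∀ e, IsPrimitive (Γ.len e) (du e) fun x => -lam * primitive (v e) x)
    (z : Γ.EdgeSobolev) :
    inner ℝ (Γ.derivL2 v) (Γ.derivL2 z) = lam * inner ℝ (Γ.toL2 v) (Γ.toL2 z) -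
      ∑ p, Γ.normalDeriv du p * Γ.endValue (Γ.toFunc z) p := by
  rw [sum_boundary, inner_derivL2, inner_toL2, sub_neg_eq_add, Finset.mul_sum,
    ← Finset.sum_add_distrib]
  refine Finset.sum_congr rfl fun e _ => ?_
  rw [integral_deriv_mul (Γ.len_pos e).le (hae e) (hprim e)]
  ring

namespace IsSolution

variable {Γ : MetricGraph E} {lam : ℝ} {v : Γ.EdgeSobolev} {du : E → ℝ → ℝ}

theorem sum_normalDeriv_mul (h : Γ.IsSolution lam v du) {z : Γ.EdgeSobolev}
    (hz : z ∈ Γ.vertexContinuous) :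
    ∑ p, Γ.normalDeriv du p * Γ.endValue (Γ.toFunc z) p = 0 :=
  Γ.glue.sum_mul_eq_zero (mem_vertexContinuous.1 hz) h.kirchhoff

theorem inner_eq (h : Γ.IsSolution lam v du) {z : Γ.EdgeSobolev} (hz : z ∈ Γ.vertexContinuous) :
    inner ℝ (Γ.derivL2 v) (Γ.derivL2 z) = lam * inner ℝ (Γ.toL2 v) (Γ.toL2 z) := by
  rw [Γ.inner_derivL2_eq h.ae_eq h.isPrimitive, h.sum_normalDeriv_mul hz, sub_zero]

theorem isEigenfunction (h : Γ.IsSolution lam v du) (hv : Γ.toFunc v ≠ 0) :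
    Γ.IsEigenfunction lam (Γ.toFunc v) := by
  refine ⟨hv, du, fun e x => -lam * primitive (v e) x, ⟨fun e => ?_, ?_, h.kirchhoff⟩, fun e => ?_⟩
  · have hℓ := (Γ.len_pos e).le
    have hp := isPrimitive_primitive hℓ (v e)
    refine ⟨?_, fun x hx y hy => ?_, fun x y => ?_⟩
    · rw [Measure.restrict_congr_set Ioc_ae_eq_Icc.symm]
      exact (hp.memLp hℓ).const_mul _
    · have hi := (h.isPrimitive e).intervalIntegrable
      rw [(h.isPrimitive e).eq_add_integral x hx, (h.isPrimitive e).eq_add_integral y hy,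
        add_sub_add_left_eq_sub]
      refine intervalIntegral.integral_interval_sub_left (hi.mono_set ?_) (hi.mono_set ?_) <;>
        rw [uIcc_of_le hℓ, uIcc_of_le (by grind)] <;> exact Icc_subset_Icc_right (by grind)
    · have hi : IntervalIntegrable (du e) volume 0 (Γ.len e) :=
        (h.isPrimitive e).intervalIntegrable_self hℓ
      rw [toFunc_apply, toFunc_apply, primitive, primitive, add_sub_add_left_eq_sub,
        intervalIntegral_congr_ae_restrict (h.ae_eq e) x.2,
        intervalIntegral_congr_ae_restrict (h.ae_eq e) y.2]
      have hx := x.2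
      have hy := y.2
      refine intervalIntegral.integral_interval_sub_left (hi.mono_set ?_) (hi.mono_set ?_) <;>
        rw [uIcc_of_le hℓ, uIcc_of_le (by grind)] <;> exact Icc_subset_Icc_right (by grind)
  · exact mem_vertexContinuous.1 h.mem
  · refine Eventually.of_forall fun x hx => ?_
    rw [toFunc_apply]; ring

end IsSolution

/-- Test functions living on one edge and vanishing at its ends give the differential equation.
Functions equal to 1 at one vertex and 0 at the others then leave only the Kirchhoff sum at that
vertex. -/
theorem exists_isSolution_of_inner_eq {Γ : MetricGraph E} {lam : ℝ} {v : Γ.EdgeSobolev}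
    (hv : v ∈ Γ.vertexContinuous)
    (h : ∀ z ∈ Γ.vertexContinuous, inner ℝ (Γ.derivL2 v) (Γ.derivL2 z) =
      lam * inner ℝ (Γ.toL2 v) (Γ.toL2 z)) : ∃ du, Γ.IsSolution lam v du := by
  classical
  have hedge : ∀ e, ∃ κ : ℝ, (v e).2 =ᵐ[volume.restrict (Ioc 0 (Γ.len e))]
      fun x => κ + ∫ t in (0 : ℝ)..x, -lam * primitive (v e) t := by
    intro e
    have hℓ := (Γ.len_pos e).le
    refine exists_ae_eq_sub_integral (Γ.len_pos e) (v e) lam fun g hg => ?_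
    have hend : ∀ p, Γ.endValue (Γ.toFunc (Pi.single e ((0 : ℝ), g))) p = 0 := by
      rintro ⟨a, i⟩
      rcases eq_or_ne a e with rfl | ha
      · cases i
        · rw [endValue_false, Pi.single_eq_same, primitive_zero]
        · rw [endValue_true, Pi.single_eq_same, primitive, hg, add_zero]
      · rw [← endEval_apply, endEval, ContinuousLinearMap.comp_apply,
          ContinuousLinearMap.comp_apply, ContinuousLinearMap.proj_apply,
          Pi.single_eq_of_ne ha, map_zero, map_zero]
    have hz := h (Pi.single e ((0 : ℝ), g))
      (mem_vertexContinuous.2 fun p q _ => by rw [hend, hend])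
    rw [PiLp.inner_apply, PiLp.inner_apply, Finset.sum_eq_single e, Finset.sum_eq_single e] at hz
    · simp only [derivL2_apply, toL2_apply, Pi.single_eq_same] at hz
      rwa [inner_primitiveL2 hℓ, inner_intervalL2 hℓ] at hz
    · intro a _ ha
      rw [toL2_apply, toL2_apply, Pi.single_eq_of_ne ha, map_zero, inner_zero_right]
    · simp
    · intro a _ ha
      rw [derivL2_apply, derivL2_apply, Pi.single_eq_of_ne ha, Prod.snd_zero, inner_zero_right]
    · simp
  choose κ hκ using hedge
  have hprim : ∀ e, IsPrimitive (Γ.len e)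
      (fun x => κ e + ∫ t in (0 : ℝ)..x, -lam * primitive (v e) t)
      fun x => -lam * primitive (v e) x := fun e =>
    IsPrimitive.intervalIntegral _ (((isPrimitive_primitive (Γ.len_pos e).le
      (v e)).intervalIntegrable_self (Γ.len_pos e).le).const_mul _)
  refine ⟨_, hv, hκ, hprim, fun p => ?_⟩
  set b : E × Bool → ℝ := fun q => if Γ.glue p q then 1 else 0 with hb
  -- Affine on each edge, with the end values prescribed by `b`.
  set z : Γ.EdgeSobolev := fun e => (b (e, false),
    (memLp_const ((b (e, true) - b (e, false)) / Γ.len e)).toLp) with hz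
  have hend : ∀ q, Γ.endValue (Γ.toFunc z) q = b q := by
    rintro ⟨e, i⟩
    cases i
    · rw [endValue_false, primitive_zero]
    · rw [endValue_true, primitive, intervalIntegral_congr_ae_restrict (MemLp.coeFn_toLp _)
        ⟨(Γ.len_pos e).le, le_rfl⟩, intervalIntegral.integral_const, smul_eq_mul, sub_zero,
        mul_div_cancel₀ _ (Γ.len_pos e).ne']
      ring
  have hzm : z ∈ Γ.vertexContinuous := by
    rw [mem_vertexContinuous]
    intro q r hqr
    rw [hend, hend, hb]
    have : Γ.glue p q ↔ Γ.glue p r :=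
      ⟨fun h => Γ.glue.trans h hqr, fun h => Γ.glue.trans h (Γ.glue.symm hqr)⟩
    simp only [this]
  have h1 := h z hzm
  rw [Γ.inner_derivL2_eq hκ hprim z] at h1
  simp only [hend, hb, mul_ite, mul_one, mul_zero] at h1
  rw [Finset.sum_filter]
  linarith

end MetricGraph

/-! ### The first excited eigenvalue as a minimum -/

namespace MetricGraph

variable {E : Type u}

theorem toFunc_add (Γ : MetricGraph E) (v w : Γ.EdgeSobolev) :
    Γ.toFunc (v + w) = Γ.toFunc v + Γ.toFunc w := by
  funext e x
  simp only [Pi.add_apply, toFunc_eq_affineFamily, map_add, ContinuousMap.add_apply]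

theorem toFunc_smul (Γ : MetricGraph E) (c : ℝ) (v : Γ.EdgeSobolev) :
    Γ.toFunc (c • v) = c • Γ.toFunc v := by
  funext e x
  simp only [Pi.smul_apply, toFunc_eq_affineFamily, map_smul, ContinuousMap.smul_apply]

theorem Connected.exists_eq_smul_oneSobolev {Γ : MetricGraph E} (hΓ : Γ.Connected)
    {v : Γ.EdgeSobolev} (hv : v ∈ Γ.vertexContinuous) (h : Γ.derivL2 v = 0) :
    ∃ c : ℝ, v = c • Γ.oneSobolev := by
  obtain ⟨⟨a⟩, hcon⟩ := hΓ
  have h2 : ∀ e, v e = ((v e).1, 0) := by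
    intro e
    refine Prod.ext rfl ?_
    rw [← derivL2_apply, h]; rfl
  have hend : ∀ p, Γ.endValue (Γ.toFunc v) p = (v p.1).1 := by
    rintro ⟨e, i⟩
    cases i
    · rw [endValue_false, primitive_zero]
    · rw [endValue_true, h2, primitive_const _ ⟨(Γ.len_pos e).le, le_rfl⟩]
  refine ⟨(v a).1, ?_⟩
  have hconst : ∀ b, (v b).1 = (v a).1 := by
    intro b
    induction hcon a b with
    | refl => rfl
    | tail _ hstep ih =>
      obtain ⟨i, j, hij⟩ := hstep
      rw [← ih]
      have := mem_vertexContinuous.1 hv _ _ hij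
      rw [hend, hend] at this
      exact this.symm
  funext b
  rw [h2 b, hconst b]
  simp [oneSobolev]

variable [Fintype E]

theorem toL2_eq_zero_of_toFunc_eq_zero {Γ : MetricGraph E} {v : Γ.EdgeSobolev}
    (h : Γ.toFunc v = 0) : Γ.toL2 v = 0 := by
  rw [← inner_self_eq_zero (𝕜 := ℝ), inner_toL2]
  refine Finset.sum_eq_zero fun e _ => ?_
  rw [intervalIntegral.integral_congr (g := fun _ => (0 : ℝ)) fun x hx => ?_]
  · simp
  · rw [uIcc_of_le (Γ.len_pos e).le] at hx
    have : primitive (v e) x = 0 := congrFun (congrFun h e) ⟨x, hx⟩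
    simp only [this, mul_zero]

namespace IsSolution

variable {Γ : MetricGraph E} {lam : ℝ} {v : Γ.EdgeSobolev} {du : E → ℝ → ℝ}

theorem norm_derivL2_sq (h : Γ.IsSolution lam v du) :
    ‖Γ.derivL2 v‖ ^ 2 = lam * ‖Γ.toL2 v‖ ^ 2 := by
  have := h.inner_eq h.mem
  rwa [real_inner_self_eq_norm_sq, real_inner_self_eq_norm_sq] at this

theorem toL2_ne_zero (h : Γ.IsSolution lam v du) (hv : Γ.toFunc v ≠ 0) : Γ.toL2 v ≠ 0 := by
  intro h0
  have h1 := h.norm_derivL2_sq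
  rw [h0, norm_zero, zero_pow two_ne_zero, mul_zero, sq_eq_zero_iff] at h1
  obtain ⟨C, hC⟩ := Γ.toL2_coercive
  have h2 := hC v
  rw [h0, h1, norm_zero, add_zero, mul_zero] at h2
  apply hv
  have h3 : v = (0 : ℝ) • v := by rw [zero_smul, ← norm_le_zero_iff]; exact h2
  rw [h3, toFunc_smul, zero_smul]

theorem nonneg (h : Γ.IsSolution lam v du) (hv : Γ.toFunc v ≠ 0) : 0 ≤ lam := by
  have h1 : 0 < ‖Γ.toL2 v‖ ^ 2 := by
    have := norm_pos_iff.2 (h.toL2_ne_zero hv); positivity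
  by_contra! hneg
  have := h.norm_derivL2_sq
  nlinarith [sq_nonneg ‖Γ.derivL2 v‖]

theorem inner_oneSobolev (h : Γ.IsSolution lam v du) (hlam : lam ≠ 0) :
    inner ℝ (Γ.toL2 v) (Γ.toL2 Γ.oneSobolev) = (0 : ℝ) := by
  have := h.inner_eq Γ.oneSobolev_mem
  rw [derivL2_oneSobolev, inner_zero_right] at this
  exact (mul_eq_zero.1 this.symm).resolve_left hlam

end IsSolution

theorem isEigenfunction_one (Γ : MetricGraph E) [Nonempty E] :
    Γ.IsEigenfunction 0 (Γ.toFunc Γ.oneSobolev) := by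
  obtain ⟨du, hdu⟩ := exists_isSolution_of_inner_eq (lam := 0) Γ.oneSobolev_mem
    (fun z _ => by rw [derivL2_oneSobolev, inner_zero_left, zero_mul])
  refine hdu.isEigenfunction fun h => ?_
  have := toL2_eq_zero_of_toFunc_eq_zero h
  have h1 := Γ.inner_toL2_one_one
  rw [this, inner_zero_left] at h1
  exact Γ.totalLength_pos.ne h1

theorem linearIndependent_one {Γ : MetricGraph E} [Nonempty E] {w : Γ.EdgeSobolev}
    (hw : inner ℝ (Γ.toL2 w) (Γ.toL2 Γ.oneSobolev) = (0 : ℝ)) (hw0 : Γ.toL2 w ≠ 0) :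
    LinearIndependent ℝ ![Γ.toFunc Γ.oneSobolev, Γ.toFunc w] := by
  rw [LinearIndependent.pair_iff]
  intro s t hst
  rw [← toFunc_smul, ← toFunc_smul, ← toFunc_add] at hst
  have h0 := toL2_eq_zero_of_toFunc_eq_zero hst
  rw [map_add, map_smul, map_smul] at h0
  have hs : s = 0 := by
    have := congrArg (fun y => inner ℝ y (Γ.toL2 Γ.oneSobolev)) h0
    simp only [inner_add_left, real_inner_smul_left, hw, mul_zero, add_zero, inner_zero_left,
      inner_toL2_one_one] at this
    exact (mul_eq_zero.1 this).resolve_right Γ.totalLength_pos.ne'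
  refine ⟨hs, ?_⟩
  rw [hs, zero_smul, zero_add] at h0
  exact (smul_eq_zero.1 h0).resolve_right hw0

/-- If `lam = 0`, nonnegativity forces `mu = 0`; connectedness then makes both functions constant,
hence dependent. -/
theorem Connected.pos_of_mem_excitedEigenvalues {Γ : MetricGraph E} (hΓ : Γ.Connected) {lam : ℝ}
    (h : lam ∈ Γ.excitedEigenvalues) :
    0 < lam ∧ ∃ ψ, Γ.IsEigenfunction lam ψ := by
  obtain ⟨mu, hmu, φ, ψ, hφ, hψ, hli⟩ := h
  refine ⟨?_, ψ, hψ⟩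
  have hφ0 := hφ.1
  have hψ0 := hψ.1
  obtain ⟨v, dv, rfl, hv⟩ := hφ.exists_isSolution
  obtain ⟨w, dw, rfl, hw⟩ := hψ.exists_isSolution
  refine lt_of_le_of_ne (hw.nonneg hψ0) fun hlam => ?_
  subst hlam
  obtain rfl : mu = 0 := le_antisymm hmu (hv.nonneg hφ0)
  obtain ⟨a, ha⟩ := hΓ.exists_eq_smul_oneSobolev hv.mem (by simpa using hv.norm_derivL2_sq)
  obtain ⟨b, hb⟩ := hΓ.exists_eq_smul_oneSobolev hw.mem (by simpa using hw.norm_derivL2_sq)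
  rw [LinearIndependent.pair_iff] at hli
  have := (hli b (-a) (by
    rw [ha, hb, toFunc_smul, toFunc_smul, smul_smul, smul_smul, ← add_smul]
    rw [show b * a + -a * b = 0 by ring, zero_smul])).2
  rw [neg_eq_zero] at this
  rw [ha, this, toFunc_smul, zero_smul] at hφ0
  exact hφ0 rfl

/-- The first excited eigenvalue of a connected graph is attained, and bounded by the Rayleigh
quotient of every function with zero mean. -/
theorem Connected.isLeast_lambdaOne {Γ : MetricGraph E} (hΓ : Γ.Connected) {f : Γ.EdgeSobolev}
    (hf : f ∈ Γ.vertexContinuous)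
    (hf1 : inner ℝ (Γ.toL2 f) (Γ.toL2 Γ.oneSobolev) = (0 : ℝ)) (hf0 : Γ.toL2 f ≠ 0) {r : ℝ}
    (hr : ‖Γ.derivL2 f‖ ^ 2 ≤ r * ‖Γ.toL2 f‖ ^ 2) :
    IsLeast Γ.excitedEigenvalues Γ.lambdaOne ∧ Γ.lambdaOne ≤ r := by
  have := hΓ.1
  have hsq : ∀ {v : Γ.EdgeSobolev}, Γ.toL2 v ≠ 0 → 0 < ‖Γ.toL2 v‖ ^ 2 := fun h => by
    have := norm_pos_iff.2 h; positivity
  obtain ⟨w, hw, c, hw1, hw0, hweak, hmin⟩ := Γ.exists_weak_eigenfunction ⟨f, hf, hf1, hf0⟩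
  obtain ⟨du, hsol⟩ := exists_isSolution_of_inner_eq hw hweak
  have hwf : Γ.toFunc w ≠ 0 := fun h => hw0 (toL2_eq_zero_of_toFunc_eq_zero h)
  -- The constant function, with `mu = 0`, makes `c` an excited eigenvalue. Conversely,
  -- eigenfunctions for `lam > 0` are orthogonal to constants and so compete in the minimization.
  have hleast : IsLeast Γ.excitedEigenvalues c := by
    refine ⟨⟨0, hsol.nonneg hwf, _, _, Γ.isEigenfunction_one, hsol.isEigenfunction hwf,
      linearIndependent_one hw1 hw0⟩, fun lam hlam => ?_⟩
    obtain ⟨hpos, ψ, hψ⟩ := hΓ.pos_of_mem_excitedEigenvalues hlam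
    have hψ0 := hψ.1
    obtain ⟨v, dv, rfl, hv⟩ := hψ.exists_isSolution
    have h1 := hmin v hv.mem (hv.inner_oneSobolev hpos.ne')
    rw [hv.norm_derivL2_sq] at h1
    exact le_of_mul_le_mul_right h1 (hsq (hv.toL2_ne_zero hψ0))
  have heq : Γ.lambdaOne = c := hleast.csInf_eq
  rw [heq]
  exact ⟨hleast, le_of_mul_le_mul_right ((hmin f hf hf1).trans hr) (hsq hf0)⟩

end MetricGraph

/-! ### The boundary term of the deleted edge -/

namespace IsPrimitive

variable {ℓ k : ℝ} {u du : ℝ → ℝ}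

/-- Both functions solve the same equation, so the volume terms cancel. -/
theorem green (hℓ : 0 ≤ ℓ) (hu : IsPrimitive ℓ u du)
    (hdu : IsPrimitive ℓ du fun x => -k ^ 2 * u x) {G g : ℝ → ℝ} (hG : IsPrimitive ℓ G g)
    (hg : IsPrimitive ℓ g fun x => -k ^ 2 * G x) :
    du ℓ * G ℓ - du 0 * G 0 = u ℓ * g ℓ - u 0 * g 0 := by
  have h1 := hdu.integral_mul hℓ hG
  have h2 := hu.integral_mul hℓ hg
  simp only [mul_assoc, mul_left_comm _ (-k ^ 2), intervalIntegral.integral_const_mul] at h1 h2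
  linarith

/-- Green's formula against cos(k(x − ℓ/2)), which is even about the midpoint and so sees only the
even part of `u`. -/
theorem cos_mul_sub (hℓ : 0 ≤ ℓ) (hu : IsPrimitive ℓ u du)
    (hdu : IsPrimitive ℓ du fun x => -k ^ 2 * u x) :
    Real.cos (k * ℓ / 2) * (du 0 - du ℓ) = k * Real.sin (k * ℓ / 2) * (u 0 + u ℓ) := by
  have hin : ∀ x, HasDerivAt (fun x : ℝ => k * x - k * ℓ / 2) k x := fun x => by
    simpa using ((hasDerivAt_id x).const_mul k).sub_const (k * ℓ / 2)
  have h := green hℓ hu hdu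
    (G := fun x => Real.cos (k * x - k * ℓ / 2)) (g := fun x => -k * Real.sin (k * x - k * ℓ / 2))
    (of_hasDerivAt (fun x => by convert! (hin x).cos using 1; ring) (by fun_prop))
    (of_hasDerivAt (fun x => by convert! (hin x).sin.const_mul (-k) using 1; ring) (by fun_prop))
  have e : k * ℓ - k * ℓ / 2 = k * ℓ / 2 := by ring
  simp only [e, mul_zero, zero_sub, Real.cos_neg, Real.sin_neg] at h
  linarith

/-- The odd counterpart, tested against sin(k(x − ℓ/2)). -/
theorem sin_mul_add (hℓ : 0 ≤ ℓ) (hu : IsPrimitive ℓ u du)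
    (hdu : IsPrimitive ℓ du fun x => -k ^ 2 * u x) :
    Real.sin (k * ℓ / 2) * (du 0 + du ℓ) = k * Real.cos (k * ℓ / 2) * (u ℓ - u 0) := by
  have hin : ∀ x, HasDerivAt (fun x : ℝ => k * x - k * ℓ / 2) k x := fun x => by
    simpa using ((hasDerivAt_id x).const_mul k).sub_const (k * ℓ / 2)
  have h := green hℓ hu hdu
    (G := fun x => Real.sin (k * x - k * ℓ / 2)) (g := fun x => k * Real.cos (k * x - k * ℓ / 2))
    (of_hasDerivAt (fun x => by convert! (hin x).sin using 1; ring) (by fun_prop))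
    (of_hasDerivAt (fun x => by convert! (hin x).cos.const_mul k using 1; ring) (by fun_prop))
  have e : k * ℓ - k * ℓ / 2 = k * ℓ / 2 := by ring
  simp only [e, mul_zero, zero_sub, Real.cos_neg, Real.sin_neg] at h
  linarith

end IsPrimitive

/-- The condition on the end values of an eigenfunction, freed from extended real numbers. -/
theorem cot_condition {R : ℝ≥0∞} {x y k L θ : ℝ} (hk : 0 < k) (hL : 0 < L)
    (hxy : ¬ (x = 0 ∧ y = 0))
    (hR : R = ENNReal.ofReal ((x - y) ^ 2) / ENNReal.ofReal ((x + y) ^ 2))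
    (h : ((L⁻¹ : ℝ) : EReal) ≤ ((R : EReal) * ((Real.cot θ ^ 2 : ℝ) : EReal) - 1) *
      ((k / 2 * Real.cot θ : ℝ) : EReal)) :
    Real.cot θ ≠ 0 ∧ (x + y = 0 → 0 < Real.cot θ) ∧
      (x + y ≠ 0 → L⁻¹ ≤ ((x - y) ^ 2 / (x + y) ^ 2 * Real.cot θ ^ 2 - 1) *
        (k / 2 * Real.cot θ)) := by
  have hL' : 0 < L⁻¹ := inv_pos.2 hL
  -- `Real.cot θ` is also 0 when sin θ = 0. In either case the right-hand side would be 0, even for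
  -- `R = ⊤`, so the hypothesis excludes both.
  have h0 : Real.cot θ ≠ 0 := by
    intro h0
    rw [h0, mul_zero, EReal.coe_zero, mul_zero, ← EReal.coe_zero, EReal.coe_le_coe_iff] at h
    linarith
  refine ⟨h0, fun hA => ?_, fun hA => ?_⟩
  · have hB : 0 < (x - y) ^ 2 := by
      have : x - y ≠ 0 := fun hB => hxy ⟨by linarith, by linarith⟩
      positivity
    have hRt : R = ⊤ := by
      rw [hR, hA, zero_pow two_ne_zero, ENNReal.ofReal_zero, ENNReal.div_zero]
      exact (ENNReal.ofReal_pos.2 hB).ne'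
    -- For a negative cotangent the right-hand side is `⊤` times a negative number, that is `⊥`.
    by_contra! hneg
    have hlt : k / 2 * Real.cot θ < 0 :=
      mul_neg_of_pos_of_neg (by positivity) (lt_of_le_of_ne hneg h0)
    rw [hRt, EReal.coe_ennreal_top, EReal.top_mul_coe_of_pos (by positivity),
      show (1 : EReal) = ((1 : ℝ) : EReal) from rfl, EReal.top_sub_coe,
      EReal.top_mul_coe_of_neg hlt] at h
    exact EReal.coe_ne_bot _ (le_bot_iff.1 h)
  · have hA2 : 0 < (x + y) ^ 2 := by positivity
    rw [hR, ← ENNReal.ofReal_div_of_pos hA2, EReal.coe_ennreal_ofReal,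
      max_eq_left (by positivity), ← EReal.coe_mul,
      show (1 : EReal) = ((1 : ℝ) : EReal) from rfl, ← EReal.coe_sub, ← EReal.coe_mul,
      EReal.coe_le_coe_iff] at h
    exact h

/-- Solving `hcos` and `hsin` for `dx - dy` and `dx + dy` turns the left side into tan²θ (x + y)²/L
and the right side into (k/2)(cot θ (x − y)² − tan θ (x + y)²); `hA'` is the quotient of this
inequality by tan²θ (x + y)². -/
theorem boundary_term_ge {x y dx dy k L θ : ℝ} (hk : 0 < k) (hL : 0 < L)
    (hcos : Real.cos θ * (dx - dy) = k * Real.sin θ * (x + y))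
    (hsin : Real.sin θ * (dx + dy) = k * Real.cos θ * (y - x))
    (h0 : Real.cot θ ≠ 0) (hA : x + y = 0 → 0 < Real.cot θ)
    (hA' : x + y ≠ 0 → L⁻¹ ≤ ((x - y) ^ 2 / (x + y) ^ 2 * Real.cot θ ^ 2 - 1) *
        (k / 2 * Real.cot θ)) :
    (dx - dy) ^ 2 / (k ^ 2 * L) ≤ dy * y - dx * x := by
  rw [Real.cot_eq_cos_div_sin] at *
  set s := Real.sin θ
  set c := Real.cos θ
  have hs : s ≠ 0 := fun h => h0 (by rw [h, div_zero])
  have hc : c ≠ 0 := fun h => h0 (by rw [h, zero_div])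
  have hN : dx - dy = k * s * (x + y) / c := by rw [eq_div_iff hc]; linarith
  have hP : dx + dy = k * c * (y - x) / s := by rw [eq_div_iff hs]; linarith
  have hQ : dy * y - dx * x = ((y - x) * (dx + dy) - (x + y) * (dx - dy)) / 2 := by ring
  rw [hQ, hN, hP]
  rcases eq_or_ne (x + y) 0 with h | h
  · rw [h]
    have : 0 ≤ k / 2 * (c / s) * (y - x) ^ 2 := by
      have := hA h; positivity
    calc _ = (0 : ℝ) := by simp
      _ ≤ k / 2 * (c / s) * (y - x) ^ 2 := this
      _ = _ := by ring
  · have h1 := mul_le_mul_of_nonneg_right (hA' h) (sq_nonneg (s * (x + y) / c))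
    calc (k * s * (x + y) / c) ^ 2 / (k ^ 2 * L) = L⁻¹ * (s * (x + y) / c) ^ 2 := by
          field_simp
      _ ≤ _ := h1
      _ = _ := by field_simp; ring

/-! ### Restriction to the graph without the edge -/

namespace MetricGraph

variable {E : Type u}

/-- The last exit from `e` on a chain towards `a`. -/
theorem Connected.exists_glue {Γ : MetricGraph E} (hΓ : Γ.Connected) {e a : E} (ha : a ≠ e) :
    ∃ b ≠ e, ∃ i j : Bool, Γ.glue (e, i) (b, j) := by
  induction hΓ.2 e a with
  | refl => exact absurd rfl ha
  | @tail c d _ hstep ih =>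
    rcases eq_or_ne c e with rfl | hc
    · exact ⟨d, ha, hstep⟩
    · exact ih hc

/-- The restriction of a function to the graph without the edge `e`. -/
def restrictDelete (Γ : MetricGraph E) (e : E) (v : Γ.EdgeSobolev) :
    (Γ.deleteEdge e).EdgeSobolev := fun a => v a

theorem restrictDelete_mem {Γ : MetricGraph E} (e : E) {v : Γ.EdgeSobolev}
    (hv : v ∈ Γ.vertexContinuous) :
    Γ.restrictDelete e v ∈ (Γ.deleteEdge e).vertexContinuous := by
  rw [mem_vertexContinuous] at hv ⊢
  have h : ∀ p : {a : E // a ≠ e} × Bool,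
      (Γ.deleteEdge e).endValue ((Γ.deleteEdge e).toFunc (Γ.restrictDelete e v)) p =
        Γ.endValue (Γ.toFunc v) ((p.1 : E), p.2) := by
    rintro ⟨a, i⟩
    cases i
    · rw [endValue_false, endValue_false]; rfl
    · rw [endValue_true, endValue_true]; rfl
  intro p q hpq
  rw [h, h]
  exact hv _ _ hpq

variable [Fintype E]

theorem IsSolution.isPrimitive_toFunc {Γ : MetricGraph E} {lam : ℝ} {v : Γ.EdgeSobolev}
    {du : E → ℝ → ℝ} (h : Γ.IsSolution lam v du) (e : E) :
    IsPrimitive (Γ.len e) (primitive (v e)) (du e) := by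
  have hℓ := (Γ.len_pos e).le
  refine ⟨(h.isPrimitive e).intervalIntegrable_self hℓ, fun x hx => ?_⟩
  rw [primitive_zero, primitive, intervalIntegral_congr_ae_restrict (h.ae_eq e) hx]

/-- A solution that is constant on an edge vanishes there. -/
theorem IsSolution.eq_zero_of_const {Γ : MetricGraph E} {lam : ℝ} {v : Γ.EdgeSobolev}
    {du : E → ℝ → ℝ} (h : Γ.IsSolution lam v du) (hlam : lam ≠ 0) {a : E} {c : ℝ}
    (hc : v a = (c, 0)) : c = 0 := by
  have hℓ := Γ.len_pos a
  have hcont := (h.isPrimitive a).continuousOn hℓ.le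
  -- The continuous `du a` vanishes almost everywhere, hence everywhere; its increment over the edge
  -- is also `-lam * c` times the length.
  have h0 : EqOn (du a) (fun _ => 0) (Icc 0 (Γ.len a)) := by
    refine Measure.eqOn_Icc_of_ae_eq volume hℓ.ne ?_ hcont continuousOn_const
    rw [Measure.restrict_congr_set Ioc_ae_eq_Icc.symm]
    refine (h.ae_eq a).symm.trans ?_
    rw [hc]
    exact Lp.coeFn_zero _ _ _
  have h1 := (h.isPrimitive a).eq_add_integral _ ⟨hℓ.le, le_rfl⟩
  rw [h0 ⟨hℓ.le, le_rfl⟩, h0 ⟨le_rfl, hℓ.le⟩, zero_add,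
    intervalIntegral.integral_congr (g := fun _ => -lam * c) fun x hx => ?_] at h1
  · rw [intervalIntegral.integral_const, smul_eq_mul, sub_zero] at h1
    have := mul_eq_zero.1 h1.symm
    simp only [hℓ.ne', false_or, mul_eq_zero, neg_eq_zero, hlam] at this
    exact this
  · rw [uIcc_of_le hℓ.le] at hx
    simp only [hc, primitive_const c hx]

variable [DecidableEq E]

theorem totalLength_deleteEdge (Γ : MetricGraph E) (e : E) :
    (Γ.deleteEdge e).totalLength = Γ.totalLength - Γ.len e := by
  rw [totalLength, totalLength, Fintype.sum_eq_add_sum_subtype_ne _ e, add_sub_cancel_left]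
  rfl

theorem inner_toL2_restrictDelete (Γ : MetricGraph E) (e : E) (v : Γ.EdgeSobolev) :
    inner ℝ ((Γ.deleteEdge e).toL2 (Γ.restrictDelete e v))
      ((Γ.deleteEdge e).toL2 (Γ.restrictDelete e v)) =
    inner ℝ (Γ.toL2 v) (Γ.toL2 v) -
      ∫ x in (0 : ℝ)..Γ.len e, primitive (v e) x * primitive (v e) x := by
  rw [inner_toL2, inner_toL2, Fintype.sum_eq_add_sum_subtype_ne _ e, add_sub_cancel_left]
  rfl

theorem inner_toL2_restrictDelete_one (Γ : MetricGraph E) (e : E) (v : Γ.EdgeSobolev) :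
    inner ℝ ((Γ.deleteEdge e).toL2 (Γ.restrictDelete e v))
      ((Γ.deleteEdge e).toL2 (Γ.deleteEdge e).oneSobolev) =
    inner ℝ (Γ.toL2 v) (Γ.toL2 Γ.oneSobolev) - ∫ x in (0 : ℝ)..Γ.len e, primitive (v e) x := by
  rw [inner_toL2_oneSobolev, inner_toL2_oneSobolev, Fintype.sum_eq_add_sum_subtype_ne _ e,
    add_sub_cancel_left]
  rfl

theorem inner_derivL2_restrictDelete (Γ : MetricGraph E) (e : E) (v : Γ.EdgeSobolev) :
    inner ℝ ((Γ.deleteEdge e).derivL2 (Γ.restrictDelete e v))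
      ((Γ.deleteEdge e).derivL2 (Γ.restrictDelete e v)) =
    inner ℝ (Γ.derivL2 v) (Γ.derivL2 v) - ∫ x in (0 : ℝ)..Γ.len e, (v e).2 x * (v e).2 x := by
  rw [inner_derivL2, inner_derivL2, Fintype.sum_eq_add_sum_subtype_ne _ e, add_sub_cancel_left]
  rfl

end MetricGraph

/-! ### The comparison of eigenvalues -/

-- The conclusion includes attainment, so that `lambdaOne` of the smaller graph is a genuine
-- eigenvalue and not a default value of `sInf`.
open MetricGraph in
theorem theorem6 {E : Type u} [Fintype E] [DecidableEq E] (Γ : MetricGraph E) (e : E)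
    (hΓ : Γ.Connected) (hΓdel : (Γ.deleteEdge e).Connected)
    (k : ℝ) (hk : 0 < k) (hlam : Γ.lambdaOne = k ^ 2)
    (R : ℝ≥0∞) (hR : IsGreatest (Γ.endRatios e) R)
    (hineq : (((Γ.totalLength - Γ.len e)⁻¹ : ℝ) : EReal) ≤
      ((R : EReal) * ((Real.cot (k * Γ.len e / 2) ^ 2 : ℝ) : EReal) - 1) *
        ((k / 2 * Real.cot (k * Γ.len e / 2) : ℝ) : EReal)) :
    IsLeast (Γ.deleteEdge e).excitedEigenvalues (Γ.deleteEdge e).lambdaOne ∧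
      (Γ.deleteEdge e).lambdaOne ≤ Γ.lambdaOne := by
  obtain ⟨⟨ψ, hψ, hends, hRψ⟩, -⟩ := hR
  rw [hlam] at hψ ⊢
  obtain ⟨v, du, rfl, hv⟩ := hψ.exists_isSolution
  have hk2 : k ^ 2 ≠ 0 := by positivity
  have hnonempty := hΓdel.1
  set L := (Γ.deleteEdge e).totalLength with hLdef
  have hL : 0 < L := (Γ.deleteEdge e).totalLength_pos
  rw [← totalLength_deleteEdge, ← hLdef] at hineq
  have hℓ := Γ.len_pos e
  obtain ⟨h0, hA, hA'⟩ := cot_condition hk hL hends hRψ hineq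
  rw [endValue_false, endValue_true] at hends hA hA'
  have hu := hv.isPrimitive_toFunc e
  have hdu := hv.isPrimitive e
  have hcos := hu.cos_mul_sub hℓ.le hdu
  have hQ := boundary_term_ge hk hL hcos (hu.sin_mul_add hℓ.le hdu) h0 hA hA'
  set m := ∫ x in (0 : ℝ)..Γ.len e, primitive (v e) x with hm
  have hN : du e 0 - du e (Γ.len e) = k ^ 2 * m := by
    rw [hdu.eq_add_integral _ ⟨hℓ.le, le_rfl⟩, intervalIntegral.integral_const_mul]; ring
  set r := Γ.restrictDelete e v with hr
  set T := (Γ.deleteEdge e).toL2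
  set D := (Γ.deleteEdge e).derivL2
  set o := (Γ.deleteEdge e).oneSobolev
  have hTr1 : inner ℝ (T r) (T o) = -m := by
    rw [inner_toL2_restrictDelete_one, hv.inner_oneSobolev hk2, zero_sub]
  have hTo : inner ℝ (T o) (T o) = L := inner_toL2_one_one _
  -- The mean of ψ over Γ is zero, so its mean over Γ* is `-(m / L)`; it is subtracted here.
  set f := r + (m / L) • o with hf
  have hf1 : inner ℝ (T f) (T o) = (0 : ℝ) := by
    rw [hf, map_add, map_smul, inner_add_left, real_inner_smul_left, hTr1, hTo,
      div_mul_cancel₀ _ hL.ne', neg_add_cancel]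
  have hDf : D f = D r := by
    rw [hf, map_add, map_smul, derivL2_oneSobolev, smul_zero, add_zero]
  have hTf : ‖T f‖ ^ 2 = inner ℝ (T r) (T r) - m ^ 2 / L := by
    have hTr1' : inner ℝ (T o) (T r) = -m := by rw [real_inner_comm, hTr1]
    have hTfe : T f = T r + (m / L) • T o := by rw [hf, map_add, map_smul]
    rw [← real_inner_self_eq_norm_sq, hTfe]
    simp only [inner_add_left, inner_add_right, real_inner_smul_left, inner_smul_right, hTo, hTr1,
      hTr1']
    field_simp
    ring
  have henergy := hv.inner_eq hv.mem
  have hedge := integral_deriv_mul hℓ.le (hv.ae_eq e) hdu (v e)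
  -- The bracket is Q − k²m²/L, with `hN` used to express m; it is nonnegative by `hQ`.
  have hrayleigh : ‖D f‖ ^ 2 + (du e (Γ.len e) * primitive (v e) (Γ.len e) -
      du e 0 * primitive (v e) 0 - (du e 0 - du e (Γ.len e)) ^ 2 / (k ^ 2 * L)) =
      k ^ 2 * ‖T f‖ ^ 2 := by
    rw [hTf, hDf, ← real_inner_self_eq_norm_sq, inner_derivL2_restrictDelete,
      inner_toL2_restrictDelete, henergy, hedge, hN]
    field_simp
    ring
  refine hΓdel.isLeast_lambdaOne (f := f)
    (Submodule.add_mem _ (restrictDelete_mem e hv.mem) (Submodule.smul_mem _ _ (oneSobolev_mem _)))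
    hf1 (fun hTf0 => ?_) (by linarith)
  -- If `T f = 0`, then `D f = 0` and coercivity gives `f = 0`. So ψ is constant off `e`, hence zero
  -- there because k² ≠ 0, and `m = 0`.
  have hDf0 : ‖D f‖ = 0 := by
    rw [hTf0, norm_zero, zero_pow two_ne_zero, mul_zero] at hrayleigh
    have : ‖D f‖ ^ 2 ≤ 0 := by linarith
    exact pow_eq_zero_iff two_ne_zero |>.1 (le_antisymm this (sq_nonneg _))
  have hf0 : f = 0 := by
    obtain ⟨C, hC⟩ := (Γ.deleteEdge e).toL2_coercive
    have h2 := hC f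
    rw [show (Γ.deleteEdge e).toL2 f = 0 from hTf0,
      show ‖(Γ.deleteEdge e).derivL2 f‖ = 0 from hDf0, norm_zero, add_zero, mul_zero] at h2
    exact norm_le_zero_iff.1 h2
  have hva : ∀ a (_ : a ≠ e), v a = (-(m / L), 0) := by
    intro a ha
    have : v a + (m / L) • ((1 : ℝ), (0 : IntervalL2 (Γ.len a))) = 0 := congrFun hf0 ⟨a, ha⟩
    rw [eq_neg_of_add_eq_zero_left this]
    simp
  obtain ⟨a₀⟩ := hnonempty
  have hmL := hv.eq_zero_of_const hk2 (hva a₀ a₀.2)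
  have hm0 : m = 0 := by
    rw [neg_eq_zero, div_eq_zero_iff] at hmL
    exact hmL.resolve_right hL.ne'
  -- With `m = 0` the even part of ψ on `e` drops out of `hcos`, so the end values are opposite.
  have hsum : primitive (v e) 0 + primitive (v e) (Γ.len e) = 0 := by
    rw [hN, hm0, mul_zero, mul_zero] at hcos
    have hs : Real.sin (k * Γ.len e / 2) ≠ 0 := fun h =>
      h0 (by rw [Real.cot_eq_cos_div_sin, h, div_zero])
    exact (mul_eq_zero.1 hcos.symm).resolve_left (mul_ne_zero hk.ne' hs)
  -- One end of `e` is glued to another edge, where ψ vanishes. Both end values are then zero,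
  -- against the choice of ψ.
  obtain ⟨b, hb, i, j, hij⟩ := hΓ.exists_glue a₀.2
  have hval := mem_vertexContinuous.1 hv.mem _ _ hij
  have hb0 : Γ.endValue (Γ.toFunc v) (b, j) = 0 := by
    have hvb : v b = (0, 0) := by rw [hva b hb, hm0, zero_div, neg_zero]
    cases j
    · rw [endValue_false, hvb, primitive_const _ ⟨le_rfl, (Γ.len_pos b).le⟩]
    · rw [endValue_true, hvb, primitive_const _ ⟨(Γ.len_pos b).le, le_rfl⟩]
  rw [hb0] at hval
  apply hends
  cases i
  · rw [endValue_false] at hval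
    exact ⟨hval, by linarith⟩
  · rw [endValue_true] at hval
    exact ⟨by linarith, hval⟩
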